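/- Let $\log$ denote the logarithm to base $2$. A finite set of points in the plane is in general position if no three of its points are collinear. A segment is determined by a point set $V$ if its endpoints are two distinct points of $V$. Two distinct segments cross if they share a point that is interior to both of them. A geometric graph is a finite simple graph whose vertex set is a set of points in general position in the plane and whose edges are represented by the straight-line segments connecting their endpoints. (i) There is an absolute constant $C>0$ such that, for every integer $n\ge 2$, any set of $n$ points in general position in the plane determines at least $n/2^{C\sqrt{\log n}}$ pairwise crossing segments. (ii) There is an absolute constant $c>0$ such that, for every integer $n\ge 2$ and every real $\varepsilon>(\log n)^{-2/3}$, any geometric graph with $n$ vertices and at least $n^{2-\varepsilon}$ edges has at least $n^{1-c\sqrt{\varepsilon}}$ pairwise crossing edges. -/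

import Mathlib

/-- The Euclidean plane. -/
abbrev Plane : Type := EuclideanSpace ℝ (Fin 2)

/-- No three distinct points of `V` are collinear. -/
def InGeneralPosition (V : Finset Plane) : Prop :=
  ∀ p ∈ V, ∀ q ∈ V, ∀ r ∈ V, p ≠ q → p ≠ r → q ≠ r → ¬ Collinear ℝ ({p, q, r} : Set Plane)

/-- The relative interior of the segment with the given (unordered) pair of endpoints. -/
def segmentInterior (e : Sym2 Plane) : Set Plane :=
  Sym2.lift ⟨fun p q => openSegment ℝ p q, fun p q => openSegment_symm ℝ p q⟩ e

/-- Two segments, given by their pairs of endpoints, cross if they share an interior point. -/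
def Cross (e f : Sym2 Plane) : Prop :=
  (segmentInterior e ∩ segmentInterior f).Nonempty

/-- Any two distinct segments of the family `S` cross. -/
def PairwiseCrossing (S : Finset (Sym2 Plane)) : Prop :=
  ∀ e ∈ S, ∀ f ∈ S, e ≠ f → Cross e f

/-- The (nondegenerate) segment `e` has both of its endpoints in `V`. -/
def DeterminedBy (V : Finset Plane) (e : Sym2 Plane) : Prop :=
  ¬ e.IsDiag ∧ ∀ p ∈ e, p ∈ V

/-- A geometric graph: a finite vertex set in general position in the plane, and a simple graph
on it, whose edges are represented by straight-line segments. -/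
structure GeometricGraph where
  /-- the vertex set -/
  verts : Finset Plane
  generalPosition : InGeneralPosition verts
  /-- the adjacency relation, which relates only points of the vertex set -/
  graph : SimpleGraph Plane
  support_subset : ∀ p q : Plane, graph.Adj p q → p ∈ verts ∧ q ∈ verts

namespace GeometricGraph

/-- The edges, each given by its unordered pair of endpoints. -/
def edges (G : GeometricGraph) : Set (Sym2 Plane) := G.graph.edgeSet

theorem finite_edges (G : GeometricGraph) : G.edges.Finite := by
  refine (G.verts.sym2.finite_toSet).subset ?_
  intro e he
  induction e using Sym2.ind with
  | _ p q =>
    have h := G.support_subset p q he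
    simpa using h

end GeometricGraph

/-! Let `A` and `B` be linearly separated. A pair of points of `A` is split if its line has points
of `B` on both sides. If no pair in either set were split, each set would be seen in one order from
all points of the other, and joining them in matching order would give pairwise crossing segments.

It suffices that few pairs are split, at most ρ|A|² and ρ|B|². After deleting a few points and every
other slice, `A` and `B` fall into `K` slices each, whose order is the same from every point of the
other set (`exists_leftOf_slices`). Segments from two cells of the `K × K` grid of slices cross
whenever one cell precedes the other strictly in both coordinates, so crossing families in the cells
of one diagonal can be united. This can be iterated because a line through two points of one slice
of `A` splits at most one slice of `B`: split pairs of different cells are distinct split pairs of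
`(A, B)` (`sum_card_splitPairs_le`). Their average thus drops by K², just like the squared slice
sizes, and ρ grows only by a factor 128/δ per level, δ being the edge density. After `t` levels this
gives (dK/16)^t crossing edges (`hasCrossingFamily_of_levels`).

A small initial ρ comes from `exists_three_subsets`: every set has three subsets of linear size that
no line splits simultaneously, so one of them is split by at most 2/3 of any given family of lines.
Iteration makes ρ = 2^(-R) at the cost of a factor 2^(O(R)) in size.

With K = 2^k, D levels, kD ≥ log m and final density 2^(-u), one needs R of order (7+u)(D+1)+k and
loses 2^(180R). For all segments, u = 0 and D = k ≈ √(log n). For density n^(-ε), the choice D ≈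
1/√ε, k ≈ √ε log n, u ≈ ε log n + 2D gives R = O(√ε log n). -/

/-! ### Cutting a finite linear order into equal slices -/

open Classical in
theorem exists_slices {α : Type*} (X : Finset α) (r : α → α → Prop)
    (hirr : ∀ x ∈ X, ¬ r x x)
    (htrans : ∀ x ∈ X, ∀ y ∈ X, ∀ z ∈ X, r x y → r y z → r x z)
    (htot : ∀ x ∈ X, ∀ y ∈ X, x ≠ y → r x y ∨ r y x)
    (N s : ℕ) (hN : N * s ≤ X.card) :
    ∃ T : ℕ → Finset α, (∀ i, T i ⊆ X) ∧ (∀ i < N, (T i).card = s) ∧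
      ∀ i j, i < j → ∀ x ∈ T i, ∀ y ∈ T j, r x y := by
  set rk : α → ℕ := fun x => (X.filter (fun z => r z x)).card with hrk
  have hmono : ∀ x ∈ X, ∀ y ∈ X, r x y → rk x < rk y := by
    intro x hx y hy hxy
    apply Finset.card_lt_card
    refine ⟨fun z hz => ?_, fun h => ?_⟩
    · simp only [Finset.mem_filter] at hz ⊢
      exact ⟨hz.1, htrans z hz.1 x hx y hy hz.2 hxy⟩
    · have := h (show x ∈ X.filter (fun z => r z y) by simp [hx, hxy])
      simp only [Finset.mem_filter] at this
      exact hirr x hx this.2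
  have hinj : Set.InjOn rk X := by
    intro x hx y hy h
    by_contra hne
    rcases htot x hx y hy hne with h' | h'
    · have := hmono x hx y hy h'; omega
    · have := hmono y hy x hx h'; omega
  have hlt : ∀ x ∈ X, rk x < X.card := by
    intro x hx
    apply Finset.card_lt_card
    refine ⟨Finset.filter_subset _ _, fun h => ?_⟩
    have := h hx
    simp only [Finset.mem_filter] at this
    exact hirr x hx this.2
  have himg : X.image rk = Finset.range X.card := by
    apply Finset.eq_of_subset_of_card_le
    · intro k hk
      obtain ⟨x, hx, rfl⟩ := Finset.mem_image.1 hk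
      exact Finset.mem_range.2 (hlt x hx)
    · rw [Finset.card_image_of_injOn hinj, Finset.card_range]
  refine ⟨fun i => X.filter (fun x => i * s ≤ rk x ∧ rk x < (i + 1) * s),
    fun i => Finset.filter_subset _ _, ?_, ?_⟩
  · intro i hi
    have hle : (i + 1) * s ≤ X.card := (Nat.mul_le_mul_right s hi).trans hN
    have : (X.filter (fun x => i * s ≤ rk x ∧ rk x < (i + 1) * s)).image rk
        = Finset.Ico (i * s) ((i + 1) * s) := by
      ext k
      simp only [Finset.mem_image, Finset.mem_filter, Finset.mem_Ico]
      constructor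
      · rintro ⟨x, hx, rfl⟩; exact hx.2
      · intro hk
        have : k ∈ X.image rk := by rw [himg]; exact Finset.mem_range.2 (by omega)
        obtain ⟨x, hx, rfl⟩ := Finset.mem_image.1 this
        exact ⟨x, ⟨hx, hk⟩, rfl⟩
    rw [← Finset.card_image_of_injOn (hinj.mono (Finset.coe_subset.2 (Finset.filter_subset _ _))), this, Nat.card_Ico]
    rw [Nat.add_mul, Nat.one_mul]; omega
  · intro i j hij x hx y hy
    simp only [Finset.mem_filter] at hx hy
    have h1 : (i + 1) * s ≤ j * s := Nat.mul_le_mul_right s hij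
    have hne : x ≠ y := by rintro rfl; omega
    rcases htot x hx.1 y hy.1 hne with h | h
    · exact h
    · have := hmono y hy.1 x hx.1 h; omega

/-! ### Orientations, splitting lines and separated sets -/

/-- Twice the signed area of the triangle `p q r`. -/
noncomputable def orient (p q r : Plane) : ℝ :=
  (q 0 - p 0) * (r 1 - p 1) - (q 1 - p 1) * (r 0 - p 0)

theorem orient_swap (p q r : Plane) : orient q p r = - orient p q r := by
  unfold orient; ring

theorem orient_self (p r : Plane) : orient p p r = 0 := by
  unfold orient; ring

theorem InGeneralPosition.orient_ne_zero {V : Finset Plane} (hV : InGeneralPosition V)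
    {p q r : Plane} (hp : p ∈ V) (hq : q ∈ V) (hr : r ∈ V) (hpq : p ≠ q) (hpr : p ≠ r)
    (hqr : q ≠ r) : orient p q r ≠ 0 := by
  intro h
  apply hV p hp q hq r hr hpq hpr hqr
  rw [collinear_iff_of_mem (p₀ := p) (by simp)]
  refine ⟨q - p, ?_⟩
  intro x hx
  simp only [Set.mem_insert_iff, Set.mem_singleton_iff] at hx
  rcases hx with rfl | rfl | rfl
  · exact ⟨0, by simp⟩
  · exact ⟨1, by simp⟩
  · unfold orient at h
    by_cases h0 : q 0 - p 0 = 0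
    · have h1 : q 1 - p 1 ≠ 0 := by
        intro h1
        apply hpq
        ext i; fin_cases i
        · simp; linarith
        · simp; linarith
      have h2 : x 0 - p 0 = 0 := by
        rw [h0, zero_mul, zero_sub, neg_eq_zero] at h
        exact (mul_eq_zero.1 h).resolve_left h1
      refine ⟨(x 1 - p 1) / (q 1 - p 1), ?_⟩
      ext i; fin_cases i
      · simp [h0]; linarith
      · simp; field_simp; ring
    · refine ⟨(x 0 - p 0) / (q 0 - p 0), ?_⟩
      ext i; fin_cases i
      · simp; field_simp; ring
      · simp; field_simp; linarith

/-- Every point of `Y` lies to the left of the directed line from `a` to `a'`. -/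
def LeftOf (Y : Finset Plane) (a a' : Plane) : Prop := ∀ b ∈ Y, 0 < orient a a' b

/-- The line through `a` and `a'` has points of `Y` strictly on both sides. -/
def Splits (Y : Finset Plane) (a a' : Plane) : Prop :=
  (∃ b ∈ Y, 0 < orient a a' b) ∧ ∃ b ∈ Y, orient a a' b < 0

theorem Splits.mono {Y Z : Finset Plane} (h : Y ⊆ Z) {a a' : Plane} (hs : Splits Y a a') :
    Splits Z a a' :=
  ⟨hs.1.imp fun _ hb => ⟨h hb.1, hb.2⟩, hs.2.imp fun _ hb => ⟨h hb.1, hb.2⟩⟩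

theorem Splits.symm {Y : Finset Plane} {a a' : Plane} (hs : Splits Y a a') :
    Splits Y a' a := by
  obtain ⟨⟨b, hb, h⟩, ⟨c, hc, h'⟩⟩ := hs
  exact ⟨⟨c, hc, by rw [orient_swap]; linarith⟩, ⟨b, hb, by rw [orient_swap]; linarith⟩⟩

theorem Splits.ne {Y : Finset Plane} {a a' : Plane} (hs : Splits Y a a') : a ≠ a' := by
  rintro rfl
  obtain ⟨⟨b, hb, h⟩, -⟩ := hs
  rw [orient_self] at h
  exact lt_irrefl _ h

/-- A linear functional strictly separates `A` from `B`. -/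
def LinSep (A B : Finset Plane) : Prop :=
  ∃ u v : ℝ, ∀ a ∈ A, ∀ b ∈ B, u * a 0 + v * a 1 < u * b 0 + v * b 1

theorem LinSep.symm {A B : Finset Plane} (h : LinSep A B) : LinSep B A := by
  obtain ⟨u, v, h⟩ := h
  exact ⟨-u, -v, fun b hb a ha => by linarith [h a ha b hb]⟩

theorem LinSep.mono {A B A' B' : Finset Plane} (h : LinSep A B) (hA : A' ⊆ A) (hB : B' ⊆ B) :
    LinSep A' B' := by
  obtain ⟨u, v, h⟩ := h
  exact ⟨u, v, fun a ha b hb => h a (hA ha) b (hB hb)⟩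

theorem LinSep.ne {A B : Finset Plane} (h : LinSep A B) {a b : Plane} (ha : a ∈ A) (hb : b ∈ B) :
    a ≠ b := by
  obtain ⟨u, v, h⟩ := h
  rintro rfl
  exact lt_irrefl _ (h a ha a hb)

/-- From a point beyond a separating line, `A` is seen within less than a half-turn, so its angular
order is transitive. The identity `key` has positive weights, the heights of `b` above the points of
`A`. -/
theorem LinSep.orient_trans {A B : Finset Plane} (h : LinSep A B) {a a' a'' b : Plane}
    (ha : a ∈ A) (ha' : a' ∈ A) (ha'' : a'' ∈ A) (hb : b ∈ B) (h1 : 0 < orient a a' b)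
    (h2 : 0 < orient a' a'' b) : 0 < orient a a'' b := by
  obtain ⟨u, v, h⟩ := h
  have e1 := sub_pos.2 (h a ha b hb)
  have e2 := sub_pos.2 (h a' ha' b hb)
  have e3 := sub_pos.2 (h a'' ha'' b hb)
  have key : (u * b 0 + v * b 1 - (u * a' 0 + v * a' 1)) * orient a a'' b
      = (u * b 0 + v * b 1 - (u * a 0 + v * a 1)) * orient a' a'' b
        + (u * b 0 + v * b 1 - (u * a'' 0 + v * a'' 1)) * orient a a' b := by
    unfold orient; ring
  rw [← mul_pos_iff_of_pos_left e2, key]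
  exact add_pos (mul_pos e1 h2) (mul_pos e3 h1)

/-- A line through two points of `A` cannot split two sets which every point of `A` sees one after
the other. -/
theorem LinSep.not_splits_both {A B Y Z : Finset Plane} (h : LinSep A B) (hY : Y ⊆ B) (hZ : Z ⊆ B)
    {a a' : Plane} (ha : a ∈ A) (hYZ : ∀ y ∈ Y, ∀ z ∈ Z, 0 < orient y z a)
    (h1 : Splits Y a a') (h2 : Splits Z a a') : False := by
  obtain ⟨u, v, h⟩ := h
  obtain ⟨⟨b1, hb1, o1⟩, ⟨b2, hb2, o2⟩⟩ := h1
  obtain ⟨⟨b3, hb3, o3⟩, ⟨b4, hb4, o4⟩⟩ := h2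
  have f1 := sub_pos.2 (h a ha b1 (hY hb1))
  have f2 := sub_pos.2 (h a ha b2 (hY hb2))
  have f3 := sub_pos.2 (h a ha b3 (hZ hb3))
  have f4 := sub_pos.2 (h a ha b4 (hZ hb4))
  have p14 := hYZ b1 hb1 b4 hb4
  have p23 := hYZ b2 hb2 b3 hb3
  -- The line leaves `a` towards the side of `B` along at most one ray, through `a'` or opposite to
  -- it. That ray would lie in the angular ranges of both `Y` and `Z`, which are disjoint.
  rcases le_or_gt 0 (u * a' 0 + v * a' 1 - (u * a 0 + v * a 1)) with hv | hv
  · have key : (u * b1 0 + v * b1 1 - (u * a 0 + v * a 1)) * orient a a' b4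
      = (u * a' 0 + v * a' 1 - (u * a 0 + v * a 1)) * orient b1 b4 a
        + (u * b4 0 + v * b4 1 - (u * a 0 + v * a 1)) * orient a a' b1 := by
      unfold orient; ring
    have := mul_pos f4 o1
    have := mul_nonneg hv p14.le
    have := mul_neg_of_pos_of_neg f1 o4
    linarith
  · have key : (u * b2 0 + v * b2 1 - (u * a 0 + v * a 1)) * orient a a' b3
      = (u * a' 0 + v * a' 1 - (u * a 0 + v * a 1)) * orient b2 b3 a
        + (u * b3 0 + v * b3 1 - (u * a 0 + v * a 1)) * orient a a' b2 := by
      unfold orient; ring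
    have := mul_pos f2 o3
    have := mul_neg_of_neg_of_pos hv p23
    have := mul_neg_of_pos_of_neg f3 o2
    linarith

theorem leftOf_or_of_not_splits {V X Y : Finset Plane} (hV : InGeneralPosition V) (hX : X ⊆ V)
    (hY : Y ⊆ V) (h : LinSep X Y) {a a' : Plane} (ha : a ∈ X) (ha' : a' ∈ X) (hne : a ≠ a')
    (hs : ¬ Splits Y a a') : LeftOf Y a a' ∨ LeftOf Y a' a := by
  by_contra hcon
  push Not at hcon
  apply hs
  simp only [LeftOf, not_forall] at hcon
  obtain ⟨⟨b, hb, h1⟩, ⟨c, hc, h2⟩⟩ := hcon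
  have nb := hV.orient_ne_zero (hX ha) (hX ha') (hY hb) hne (h.ne ha hb) (h.ne ha' hb)
  have nc := hV.orient_ne_zero (hX ha') (hX ha) (hY hc) hne.symm (h.ne ha' hc) (h.ne ha hc)
  rw [orient_swap] at h2 nc
  refine ⟨⟨c, hc, ?_⟩, ⟨b, hb, lt_of_le_of_ne (not_lt.1 h1) nb⟩⟩
  have : orient a a' c ≠ 0 := fun h => nc (by simp [h])
  exact lt_of_le_of_ne (by linarith) this.symm

/-! ### Slices seen in the same order from the other set -/

open Classical in
/-- The ordered pairs of points of `X` whose line splits `Y`. -/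
noncomputable def splitPairs (X Y : Finset Plane) : Finset (Plane × Plane) :=
  (X ×ˢ X).filter fun p => Splits Y p.1 p.2

theorem mem_splitPairs {X Y : Finset Plane} {p : Plane × Plane} :
    p ∈ splitPairs X Y ↔ p.1 ∈ X ∧ p.2 ∈ X ∧ Splits Y p.1 p.2 := by
  simp [splitPairs, and_assoc]

open Classical in
/-- If few lines through two points of `X` split `Y`, then most of `X` can be cut into slices of
equal size such that non-adjacent slices are seen in the same order from all points of `Y`. -/
theorem exists_leftOf_slices {V X Y : Finset Plane} (hV : InGeneralPosition V) (hX : X ⊆ V)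
    (hY : Y ⊆ V) (h : LinSep X Y) (hne : Y.Nonempty) (N s t : ℕ) (hs : 0 < s)
    (hst : 2 * (splitPairs X Y).card ≤ s * t) (hN : t + N * s ≤ X.card) :
    ∃ T : ℕ → Finset Plane, (∀ i, T i ⊆ X) ∧ (∀ i < N, (T i).card = s) ∧
      (∀ i j, i ≠ j → Disjoint (T i) (T j)) ∧
      ∀ i j, i + 2 ≤ j → j < N → ∀ x ∈ T i, ∀ y ∈ T j, LeftOf Y x y := by
  obtain ⟨b, hb⟩ := hne
  set dg : Plane → Finset Plane := fun x => X.filter (fun z => Splits Y x z) with hdg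
  -- Points lying in at least s/2 split pairs are discarded; double counting leaves at most `t` of
  -- them.
  set X' := X.filter (fun x => 2 * (dg x).card < s) with hX'
  have hbad : (X.filter (fun x => ¬ 2 * (dg x).card < s)).card * s ≤ 2 * (splitPairs X Y).card := by
    have h1 : (splitPairs X Y).card = ∑ x ∈ X, (dg x).card := by
      simp only [splitPairs, hdg, Finset.card_filter, Finset.sum_product]
    rw [h1, Finset.mul_sum, ← smul_eq_mul]
    refine (Finset.card_nsmul_le_sum _ (fun x => 2 * (dg x).card) s ?_).trans
      (Finset.sum_le_sum_of_subset (Finset.filter_subset _ _))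
    intro x hx
    simpa using (Finset.mem_filter.1 hx).2
  have hbad' : (X.filter (fun x => ¬ 2 * (dg x).card < s)).card ≤ t := by
    have := hbad.trans hst
    rw [mul_comm] at this
    exact Nat.le_of_mul_le_mul_left this hs
  have hcard : N * s ≤ X'.card := by
    have := Finset.card_filter_add_card_filter_not (s := X) (fun x => 2 * (dg x).card < s)
    rw [hX']; omega
  have hsub : X' ⊆ X := Finset.filter_subset _ _
  have hirr : ∀ x, ¬ 0 < orient x x b := fun x => by rw [orient_self]; exact lt_irrefl _
  obtain ⟨T, hT1, hT2, hT3⟩ := exists_slices X' (fun x y => 0 < orient x y b)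
    (fun x _ => hirr x)
    (fun x hx y hy z hz => h.orient_trans (hsub hx) (hsub hy) (hsub hz) hb)
    (fun x hx y hy hxy => by
      have := hV.orient_ne_zero (hX (hsub hx)) (hX (hsub hy)) (hY hb) hxy (h.ne (hsub hx) hb)
        (h.ne (hsub hy) hb)
      rw [orient_swap x y b]
      rcases lt_or_gt_of_ne this with h' | h'
      · right; linarith
      · left; exact h') N s hcard
  refine ⟨T, fun i => (hT1 i).trans hsub, hT2, ?_, ?_⟩
  · have aux : ∀ i j, i < j → Disjoint (T i) (T j) := by
      intro i j hij
      rw [Finset.disjoint_left]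
      intro x hx hx'
      exact hirr x (hT3 i j hij x hx x hx')
    intro i j hij
    rcases lt_or_gt_of_ne hij with h' | h'
    · exact aux i j h'
    · exact (aux j i h').symm
  · intro i j hij hj x hx y hy
    have hx' := Finset.mem_filter.1 (hT1 i hx)
    have hy' := Finset.mem_filter.1 (hT1 j hy)
    -- A whole slice of `s` points lies between `x` and `y`, and each of them spoils fewer than s/2
    -- of it. Through an unspoiled `z`, the order seen from `b` carries over to all of `Y`. Adjacent
    -- slices offer no such `z`.
    have hz : ∃ z ∈ T (i + 1), z ∉ dg x ∪ dg y := by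
      by_contra hcon
      push Not at hcon
      have h1 := (Finset.card_le_card (show T (i + 1) ⊆ dg x ∪ dg y from hcon)).trans
        (Finset.card_union_le _ _)
      rw [hT2 (i + 1) (by omega)] at h1
      omega
    obtain ⟨z, hz, hzn⟩ := hz
    have hzX := hsub (hT1 _ hz)
    have h1 := hT3 i (i + 1) (by omega) x hx z hz
    have h2 := hT3 (i + 1) j (by omega) z hz y hy
    have key : ∀ p ∈ X, ∀ q ∈ X, ¬ Splits Y p q → 0 < orient p q b → LeftOf Y p q := by
      intro p hp q hq hpq ho
      have hne : p ≠ q := by rintro rfl; exact hirr _ ho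
      rcases leftOf_or_of_not_splits hV hX hY h hp hq hne hpq with h' | h'
      · exact h'
      · have := h' b hb
        rw [orient_swap] at this
        linarith
    simp only [hdg, Finset.mem_union, Finset.mem_filter, not_or, not_and] at hzn
    have k1 := key x hx'.1 z hzX (hzn.1 hzX) h1
    have k2 := key z hzX y hy'.1 (fun hh => hzn.2 hzX hh.symm) h2
    intro c hc
    exact h.orient_trans hx'.1 hzX hy'.1 hc (k1 c hc) (k2 c hc)

/-! ### Edges and split pairs over a grid of slices -/

open Classical in
/-- The pairs of `A ×ˢ B` related by `E`. -/
noncomputable def edgesBetween (E : Plane → Plane → Prop) (A B : Finset Plane) :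
    Finset (Plane × Plane) :=
  (A ×ˢ B).filter fun p => E p.1 p.2

open Classical in
theorem mem_edgesBetween {E : Plane → Plane → Prop} {A B : Finset Plane} {p : Plane × Plane} :
    p ∈ edgesBetween E A B ↔ p.1 ∈ A ∧ p.2 ∈ B ∧ E p.1 p.2 := by
  simp [edgesBetween, and_assoc]

open Classical in
theorem card_edgesBetween_le (E : Plane → Plane → Prop) (A B : Finset Plane) :
    (edgesBetween E A B).card ≤ A.card * B.card := by
  rw [← Finset.card_product]
  exact Finset.card_le_card (Finset.filter_subset _ _)

-- The sets of split pairs of distinct cells are disjoint: a pair lies in only one `T i`, and by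
-- `LinSep.not_splits_both` its line splits at most one `U j`.
open Classical in
theorem sum_card_splitPairs_le {A B : Finset Plane} (h : LinSep A B) {T U : ℕ → Finset Plane}
    {K : ℕ} (hT : ∀ i, T i ⊆ A) (hU : ∀ i, U i ⊆ B)
    (hTd : ∀ i j, i ≠ j → Disjoint (T i) (T j))
    (hUo : ∀ i j, i < j → j < K → ∀ x ∈ U i, ∀ y ∈ U j, LeftOf A x y) :
    ∑ i ∈ Finset.range K, ∑ j ∈ Finset.range K, (splitPairs (T i) (U j)).card
      ≤ (splitPairs A B).card := by
  rw [← Finset.sum_product' (f := fun i j => (splitPairs (T i) (U j)).card), ← Finset.card_biUnion]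
  · apply Finset.card_le_card
    intro p hp
    obtain ⟨ij, -, hp⟩ := Finset.mem_biUnion.1 hp
    rw [mem_splitPairs] at hp ⊢
    exact ⟨hT _ hp.1, hT _ hp.2.1, hp.2.2.mono (hU _)⟩
  · have aux : ∀ j j', j < j' → j' < K → ∀ a ∈ A, ∀ a', Splits (U j) a a' → Splits (U j') a a' →
        False := fun j j' hj hj' a ha a' h1 h2 =>
      h.not_splits_both (hU j) (hU j') ha
        (fun y hy z hz => hUo j j' hj hj' y hy z hz a ha) h1 h2
    rintro ⟨i, j⟩ hij ⟨i', j'⟩ hij' hne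
    simp only [Finset.coe_product, Finset.coe_range, Set.mem_prod, Set.mem_Iio] at hij hij'
    rw [Function.onFun, Finset.disjoint_left]
    intro p hp hp'
    simp only [mem_splitPairs] at hp hp'
    by_cases hi : i = i'
    · have hj : j ≠ j' := fun hj => hne (by rw [hi, hj])
      rcases lt_or_gt_of_ne hj with h' | h'
      · exact aux j j' h' hij'.2 _ (hT _ hp.1) _ hp.2.2 hp'.2.2
      · exact aux j' j h' hij.2 _ (hT _ hp.1) _ hp'.2.2 hp.2.2
    · exact Finset.disjoint_left.1 (hTd i i' hi) hp.1 hp'.1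

open Classical in
theorem card_edgesBetween_le_sum (E : Plane → Plane → Prop) {A B : Finset Plane}
    {T U : ℕ → Finset Plane} {N s t : ℕ} (hT : ∀ i, T i ⊆ A) (hU : ∀ i, U i ⊆ B)
    (hTd : ∀ i j, i ≠ j → Disjoint (T i) (T j)) (hUd : ∀ i j, i ≠ j → Disjoint (U i) (U j))
    (hTs : ∀ i < N, (T i).card = s) (hUs : ∀ i < N, (U i).card = t) :
    (edgesBetween E A B).card ≤
      ∑ i ∈ Finset.range N, ∑ j ∈ Finset.range N, (edgesBetween E (T i) (U j)).card
        + (A.card - N * s) * B.card + A.card * (B.card - N * t) := by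
  set T' := (Finset.range N).biUnion T
  set U' := (Finset.range N).biUnion U
  have hT' : T'.card = N * s := by
    rw [Finset.card_biUnion (fun i _ j _ hij => hTd i j hij),
      Finset.sum_congr rfl (fun i hi => hTs i (Finset.mem_range.1 hi))]
    simp
  have hU' : U'.card = N * t := by
    rw [Finset.card_biUnion (fun i _ j _ hij => hUd i j hij),
      Finset.sum_congr rfl (fun i hi => hUs i (Finset.mem_range.1 hi))]
    simp
  have hTA : T' ⊆ A := Finset.biUnion_subset.2 fun i _ => hT i
  have hUB : U' ⊆ B := Finset.biUnion_subset.2 fun i _ => hU i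
  have hsub : edgesBetween E A B ⊆
      ((Finset.range N ×ˢ Finset.range N).biUnion fun ij => edgesBetween E (T ij.1) (U ij.2))
        ∪ (A \ T') ×ˢ B ∪ A ×ˢ (B \ U') := by
    intro p hp
    rw [mem_edgesBetween] at hp
    simp only [Finset.mem_union, Finset.mem_biUnion, Finset.mem_product, Finset.mem_sdiff,
      mem_edgesBetween]
    by_cases h1 : p.1 ∈ T'
    · by_cases h2 : p.2 ∈ U'
      · obtain ⟨i, hi, hi'⟩ := Finset.mem_biUnion.1 h1
        obtain ⟨j, hj, hj'⟩ := Finset.mem_biUnion.1 h2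
        exact Or.inl (Or.inl ⟨(i, j), ⟨hi, hj⟩, hi', hj', hp.2.2⟩)
      · exact Or.inr ⟨hp.1, hp.2.1, h2⟩
    · exact Or.inl (Or.inr ⟨⟨hp.1, h1⟩, hp.2.1⟩)
  refine (Finset.card_le_card hsub).trans ((Finset.card_union_le _ _).trans ?_)
  rw [Finset.card_product, Finset.card_sdiff_of_subset hUB, hU']
  refine Nat.add_le_add_right ((Finset.card_union_le _ _).trans ?_) _
  rw [Finset.card_product, Finset.card_sdiff_of_subset hTA, hT']
  refine Nat.add_le_add_right ?_ _
  rw [← Finset.sum_product' (f := fun i j => (edgesBetween E (T i) (U j)).card)]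
  exact Finset.card_biUnion_le

theorem sum_range_two_mul_sq (f : ℕ → ℕ → ℕ) (K : ℕ) :
    ∑ i ∈ Finset.range (2 * K), ∑ j ∈ Finset.range (2 * K), f i j
      = (∑ i ∈ Finset.range K, ∑ j ∈ Finset.range K, f (2 * i) (2 * j))
        + (∑ i ∈ Finset.range K, ∑ j ∈ Finset.range K, f (2 * i) (2 * j + 1))
        + (∑ i ∈ Finset.range K, ∑ j ∈ Finset.range K, f (2 * i + 1) (2 * j))
        + (∑ i ∈ Finset.range K, ∑ j ∈ Finset.range K, f (2 * i + 1) (2 * j + 1)) := by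
  have key : ∀ g : ℕ → ℕ, ∑ i ∈ Finset.range (2 * K), g i
      = ∑ i ∈ Finset.range K, (g (2 * i) + g (2 * i + 1)) := by
    intro g
    induction K with
    | zero => simp
    | succ k ih =>
      rw [show 2 * (k + 1) = 2 * k + 1 + 1 by ring, Finset.sum_range_succ, Finset.sum_range_succ,
        ih, Finset.sum_range_succ]
      ring
  rw [key]
  simp only [key, Finset.sum_add_distrib]
  ring

/-- Simultaneous slicing of two separated sets which see each other in nearly constant orders. -/
theorem exists_slices_pair {V A B : Finset Plane} (hV : InGeneralPosition V) (hA : A ⊆ V)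
    (hB : B ⊆ V) (h : LinSep A B) (E : Plane → Plane → Prop) (K s t : ℕ) (hs : 0 < s) (ht : 0 < t)
    (hK : 0 < K) (hsA : 2 * K * s ≤ A.card) (htB : 2 * K * t ≤ B.card)
    (hsp : 2 * (splitPairs A B).card ≤ s * (A.card - 2 * K * s))
    (htp : 2 * (splitPairs B A).card ≤ t * (B.card - 2 * K * t)) :
    ∃ T U : ℕ → Finset Plane, (∀ i, T i ⊆ A) ∧ (∀ i, U i ⊆ B) ∧
      (∀ i < K, (T i).card = s) ∧ (∀ i < K, (U i).card = t) ∧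
      (∀ i j, i < j → j < K → ∀ x ∈ T i, ∀ y ∈ T j, LeftOf B x y) ∧
      (∀ i j, i < j → j < K → ∀ x ∈ U i, ∀ y ∈ U j, LeftOf A x y) ∧
      (∑ i ∈ Finset.range K, ∑ j ∈ Finset.range K, (splitPairs (T i) (U j)).card
        ≤ (splitPairs A B).card) ∧
      (∑ i ∈ Finset.range K, ∑ j ∈ Finset.range K, (splitPairs (U j) (T i)).card
        ≤ (splitPairs B A).card) ∧
      (edgesBetween E A B).card ≤
        4 * ∑ i ∈ Finset.range K, ∑ j ∈ Finset.range K, (edgesBetween E (T i) (U j)).card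
        + (A.card - 2 * K * s) * B.card + A.card * (B.card - 2 * K * t) := by
  have hAne : A.Nonempty := Finset.card_pos.1 (lt_of_lt_of_le (by positivity) hsA)
  have hBne : B.Nonempty := Finset.card_pos.1 (lt_of_lt_of_le (by positivity) htB)
  obtain ⟨T, hT1, hT2, hT3, hT4⟩ := exists_leftOf_slices hV hA hB h hBne (2 * K) s _ hs hsp
    (by omega)
  obtain ⟨U, hU1, hU2, hU3, hU4⟩ := exists_leftOf_slices hV hB hA h.symm hAne (2 * K) t _ ht htp
    (by omega)
  have hE := card_edgesBetween_le_sum E hT1 hU1 hT3 hU3 hT2 hU2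
  rw [sum_range_two_mul_sq (fun i j => (edgesBetween E (T i) (U j)).card)] at hE
  -- Keeping one parity class of slices on each side makes distinct slices non-adjacent. One of the
  -- four choices carries at least a quarter of the edges.
  obtain ⟨a, b, hab⟩ : ∃ a b : ℕ, a < 2 ∧ b < 2 ∧ (edgesBetween E A B).card ≤
        4 * ∑ i ∈ Finset.range K, ∑ j ∈ Finset.range K,
          (edgesBetween E (T (2 * i + a)) (U (2 * j + b))).card
        + (A.card - 2 * K * s) * B.card + A.card * (B.card - 2 * K * t) := by
    by_contra hcon
    push Not at hcon
    have h00 := hcon 0 0 (by norm_num) (by norm_num)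
    have h01 := hcon 0 1 (by norm_num) (by norm_num)
    have h10 := hcon 1 0 (by norm_num) (by norm_num)
    have h11 := hcon 1 1 (by norm_num) (by norm_num)
    simp only [Nat.add_zero] at h00 h01 h10
    omega
  obtain ⟨ha, hb, hab⟩ := hab
  refine ⟨fun i => T (2 * i + a), fun j => U (2 * j + b), fun i => hT1 _, fun i => hU1 _,
    fun i hi => hT2 _ (by omega), fun i hi => hU2 _ (by omega),
    fun i j hij hj => hT4 _ _ (by omega) (by omega),
    fun i j hij hj => hU4 _ _ (by omega) (by omega), ?_, ?_, hab⟩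
  · exact sum_card_splitPairs_le h (T := fun i => T (2 * i + a)) (U := fun j => U (2 * j + b))
      (fun i => hT1 _) (fun i => hU1 _) (fun i j hij => hT3 _ _ (by omega))
      (fun i j hij hj => hU4 _ _ (by omega) (by omega))
  · rw [Finset.sum_comm]
    exact sum_card_splitPairs_le h.symm (T := fun j => U (2 * j + b))
      (U := fun i => T (2 * i + a))
      (fun i => hU1 _) (fun i => hT1 _) (fun i j hij => hU3 _ _ (by omega))
      (fun i j hij hj => hT4 _ _ (by omega) (by omega))

/-! ### One level of the recursion -/

open Classical in
/-- A set of cells of a square grid contains a large strictly increasing chain. -/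
theorem exists_diagonal (P : Finset (ℕ × ℕ)) (K : ℕ)
    (hP : ∀ p ∈ P, p.1 < K ∧ p.2 < K) :
    ∃ I ⊆ P, P.card ≤ 2 * K * I.card ∧
      ∀ p ∈ I, ∀ q ∈ I, p ≠ q → (p.1 < q.1 ∧ p.2 < q.2) ∨ (q.1 < p.1 ∧ q.2 < p.2) := by
  rcases Nat.eq_zero_or_pos K with rfl | hK
  · refine ⟨∅, by simp, ?_, by simp⟩
    have : P = ∅ := Finset.eq_empty_of_forall_notMem fun p hp => by have := hP p hp; omega
    simp [this]
  by_contra hcon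
  push Not at hcon
  -- The value `c` indexes a diagonal, on which distinct cells are always strictly comparable.
  -- Adding `K` keeps the natural subtraction exact; at most 2K diagonals occur.
  have hI : ∀ c, (P.filter fun p => p.1 + K - p.2 = c).card * (2 * K) < P.card := by
    intro c
    by_contra hc
    obtain ⟨p, hp, q, hq, hne, h1⟩ := hcon (P.filter fun p => p.1 + K - p.2 = c)
      (Finset.filter_subset _ _) (by rw [mul_comm]; exact not_lt.1 hc)
    simp only [Finset.mem_filter] at hp hq
    have b1 := hP p hp.1
    have b2 := hP q hq.1
    apply hne
    ext <;> omega
  have hsum := Finset.card_eq_sum_card_fiberwise (s := P) (t := Finset.range (2 * K))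
    (f := fun p : ℕ × ℕ => p.1 + K - p.2) (fun p hp => by
      have := hP p hp
      simp only [Finset.coe_range, Set.mem_Iio]
      omega)
  have hlt : ∑ c ∈ Finset.range (2 * K), (P.filter fun p => p.1 + K - p.2 = c).card * (2 * K)
      < ∑ c ∈ Finset.range (2 * K), P.card :=
    Finset.sum_lt_sum_of_nonempty ⟨0, by simp [hK]⟩ fun c _ => hI c
  rw [← Finset.sum_mul, ← hsum, Finset.sum_const, Finset.card_range, smul_eq_mul,
    mul_comm] at hlt
  exact lt_irrefl _ hlt

/-- The waste must be at least δm/8 to absorb the points in many split pairs, but at most 3δm/16 so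
that both sides together lose at most 3/8 of the edges. Rounding costs at most 2K ≤ δm/16. -/
theorem exists_slice_size (m K : ℕ) (hK : 0 < K) (δ : ℝ) (hδ : 0 < δ) (hδ1 : δ ≤ 1)
    (hm : 32 * K / δ ≤ m) :
    ∃ s : ℕ, 0 < s ∧ 2 * K * s ≤ m ∧ (m : ℝ) / (4 * K) ≤ s ∧
      δ * m / 8 ≤ (m : ℝ) - 2 * K * s ∧ (m : ℝ) - 2 * K * s ≤ 3 / 16 * δ * m := by
  have hK' : (0 : ℝ) < K := by exact_mod_cast hK
  have hm' : 32 * (K : ℝ) ≤ δ * m := by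
    rw [div_le_iff₀ hδ] at hm; linarith
  have hm0 : (0 : ℝ) ≤ m := by positivity
  have hδm : δ * m ≤ m := by nlinarith
  set x : ℝ := (1 - δ / 8) * m / (2 * K) with hx
  have hx2 : 2 * K * x = (1 - δ / 8) * m := by rw [hx]; field_simp
  have hx0 : 0 ≤ x := by rw [hx]; apply div_nonneg (mul_nonneg (by linarith) hm0); positivity
  have h1 : (⌊x⌋₊ : ℝ) ≤ x := Nat.floor_le hx0
  have h2 : x < ⌊x⌋₊ + 1 := Nat.lt_floor_add_one x
  have h3 : 2 * K * (⌊x⌋₊ : ℝ) ≤ (1 - δ / 8) * m := by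
    rw [← hx2]; exact mul_le_mul_of_nonneg_left h1 (by positivity)
  have h4 : (1 - δ / 8) * m ≤ 2 * K * (⌊x⌋₊ : ℝ) + 2 * K := by
    rw [← hx2]
    have := mul_le_mul_of_nonneg_left h2.le (show (0 : ℝ) ≤ 2 * K by positivity)
    linarith
  have h5 : (m : ℝ) / (4 * K) ≤ ⌊x⌋₊ := by
    rw [div_le_iff₀ (by positivity)]
    nlinarith
  refine ⟨⌊x⌋₊, ?_, ?_, h5, by linarith, by linarith⟩
  · have : (0 : ℝ) < m / (4 * K) := by apply div_pos <;> nlinarith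
    exact_mod_cast this.trans_le h5
  · have : (2 * K * ⌊x⌋₊ : ℝ) ≤ m := by nlinarith
    exact_mod_cast this

/-- One level of the recursion. -/
theorem exists_crossing_subpairs {V A B : Finset Plane} (hV : InGeneralPosition V) (hA : A ⊆ V)
    (hB : B ⊆ V) (h : LinSep A B) (E : Plane → Plane → Prop) (K : ℕ) (hK : 0 < K) (δ ρ : ℝ)
    (hδ : 0 < δ) (hδ1 : δ ≤ 1) (hρ : 0 < ρ) (hρδ : ρ ≤ δ / (64 * K))
    (hmA : 32 * K / δ ≤ A.card) (hmB : 32 * K / δ ≤ B.card)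
    (hAB : ((splitPairs A B).card : ℝ) ≤ ρ * (A.card : ℝ) ^ 2)
    (hBA : ((splitPairs B A).card : ℝ) ≤ ρ * (B.card : ℝ) ^ 2)
    (hE : δ * A.card * B.card ≤ (edgesBetween E A B).card) :
    ∃ (I : Finset (ℕ × ℕ)) (T U : ℕ → Finset Plane), δ * K / 16 ≤ I.card ∧
      (∀ i, T i ⊆ A) ∧ (∀ i, U i ⊆ B) ∧
      (∀ p ∈ I, ∀ q ∈ I, p ≠ q → (p.1 < q.1 ∧ p.2 < q.2) ∨ (q.1 < p.1 ∧ q.2 < p.2)) ∧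
      (∀ p ∈ I, ∀ q ∈ I, p.1 < q.1 → ∀ x ∈ T p.1, ∀ y ∈ T q.1, LeftOf B x y) ∧
      (∀ p ∈ I, ∀ q ∈ I, p.2 < q.2 → ∀ x ∈ U p.2, ∀ y ∈ U q.2, LeftOf A x y) ∧
      ∀ p ∈ I, (A.card : ℝ) / (4 * K) ≤ (T p.1).card ∧ (B.card : ℝ) / (4 * K) ≤ (U p.2).card ∧
        ((splitPairs (T p.1) (U p.2)).card : ℝ) ≤ 128 * ρ / δ * ((T p.1).card : ℝ) ^ 2 ∧
        ((splitPairs (U p.2) (T p.1)).card : ℝ) ≤ 128 * ρ / δ * ((U p.2).card : ℝ) ^ 2 ∧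
        δ / 4 * (T p.1).card * (U p.2).card ≤ (edgesBetween E (T p.1) (U p.2)).card := by
  have hK' : (0 : ℝ) < K := by exact_mod_cast hK
  obtain ⟨s, hs, hsA, hs4, hs5, hs6⟩ := exists_slice_size A.card K hK δ hδ hδ1 hmA
  obtain ⟨t, ht, htB, ht4, ht5, ht6⟩ := exists_slice_size B.card K hK δ hδ hδ1 hmB
  have few : ∀ (c m s : ℕ), 2 * K * s ≤ m → (c : ℝ) ≤ ρ * (m : ℝ) ^ 2 → (m : ℝ) / (4 * K) ≤ s →
      δ * m / 8 ≤ (m : ℝ) - 2 * K * s → 2 * c ≤ s * (m - 2 * K * s) := by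
    intro c m s hm hc h4 h5
    have : (2 * c : ℝ) ≤ s * (m - 2 * K * s) := by
      have e1 : (m : ℝ) / (4 * K) * (δ * m / 8) ≤ s * (m - 2 * K * s) :=
        mul_le_mul h4 h5 (by positivity) (by positivity)
      have e2 : ρ * (m : ℝ) ^ 2 ≤ δ / (64 * K) * (m : ℝ) ^ 2 :=
        mul_le_mul_of_nonneg_right hρδ (by positivity)
      have e3 : (m : ℝ) / (4 * K) * (δ * m / 8) = 2 * (δ / (64 * K) * (m : ℝ) ^ 2) := by
        field_simp; ring
      linarith
    have h' : ((2 * c : ℕ) : ℝ) ≤ ((s * (m - 2 * K * s) : ℕ) : ℝ) := by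
      push_cast [Nat.cast_sub hm]; exact this
    exact_mod_cast h'
  obtain ⟨T, U, hT, hU, hTs, hUt, hTo, hUo, hsum1, hsum2, hsumE⟩ :=
    exists_slices_pair hV hA hB h E K s t hs ht hK hsA htB (few _ _ _ hsA hAB hs4 hs5)
      (few _ _ _ htB hBA ht4 ht5)
  have hs0 : (0 : ℝ) < s := by exact_mod_cast hs
  have ht0 : (0 : ℝ) < t := by exact_mod_cast ht
  set Q := Finset.range K ×ˢ Finset.range K with hQ
  have hQc : (Q.card : ℝ) = (K : ℝ) ^ 2 := by
    rw [hQ, Finset.card_product, Finset.card_range]; push_cast; ring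
  have hTU : ∀ p ∈ Q, (T p.1).card = s ∧ (U p.2).card = t := by
    intro p hp
    simp only [hQ, Finset.mem_product, Finset.mem_range] at hp
    exact ⟨hTs _ hp.1, hUt _ hp.2⟩
  rw [← Finset.sum_product' (f := fun i j => (splitPairs (T i) (U j)).card)] at hsum1
  rw [← Finset.sum_product' (f := fun i j => (splitPairs (U j) (T i)).card)] at hsum2
  rw [← Finset.sum_product' (f := fun i j => (edgesBetween E (T i) (U j)).card)] at hsumE
  classical
  -- few grid cells are split too often
  have bad : ∀ (f : ℕ × ℕ → ℕ) (c m s : ℕ), 0 < (s : ℝ) → (m : ℝ) / (4 * K) ≤ s →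
      ∑ p ∈ Q, f p ≤ c → (c : ℝ) ≤ ρ * (m : ℝ) ^ 2 →
      ((Q.filter fun p => 128 * ρ / δ * (s : ℝ) ^ 2 < f p).card : ℝ) ≤ δ * (K : ℝ) ^ 2 / 8 := by
    intro f c m s hs hms hsum hc
    have h1 := Finset.card_nsmul_le_sum (Q.filter fun p => 128 * ρ / δ * (s : ℝ) ^ 2 < f p)
      (fun p => (f p : ℝ)) (128 * ρ / δ * (s : ℝ) ^ 2) (fun p hp => (Finset.mem_filter.1 hp).2.le)
    have h2 : ∑ p ∈ Q.filter (fun p => 128 * ρ / δ * (s : ℝ) ^ 2 < f p), (f p : ℝ)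
        ≤ ∑ p ∈ Q, (f p : ℝ) :=
      Finset.sum_le_sum_of_subset_of_nonneg (Finset.filter_subset _ _) fun _ _ _ => by positivity
    have h3 : ∑ p ∈ Q, (f p : ℝ) ≤ c := by exact_mod_cast hsum
    rw [nsmul_eq_mul] at h1
    set n := ((Q.filter fun p => 128 * ρ / δ * (s : ℝ) ^ 2 < f p).card : ℝ)
    -- Markov's inequality: the total is at most 16ρK²s², and 16/128 = 1/8 explains the factor 128.
    have h4 : (m : ℝ) ≤ s * (4 * K) := by rwa [div_le_iff₀ (by positivity)] at hms
    have h5 : (m : ℝ) ^ 2 ≤ (s * (4 * K)) ^ 2 := by gcongr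
    have h6 : n * (128 * ρ / δ * (s : ℝ) ^ 2) ≤ ρ * (s * (4 * K)) ^ 2 := by
      have := mul_le_mul_of_nonneg_left h5 hρ.le
      linarith
    have h7 : ρ * (s * (4 * K)) ^ 2 = (δ * (K : ℝ) ^ 2 / 8) * (128 * ρ / δ * (s : ℝ) ^ 2) := by
      field_simp; ring
    rw [h7] at h6
    exact le_of_mul_le_mul_right h6 (by positivity)
  have hb1 := bad (fun p => (splitPairs (T p.1) (U p.2)).card) _ _ _ hs0 hs4 hsum1 hAB
  have hb2 := bad (fun p => (splitPairs (U p.2) (T p.1)).card) _ _ _ ht0 ht4 hsum2 hBA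
  set B1 := Q.filter fun p => 128 * ρ / δ * (s : ℝ) ^ 2 < (splitPairs (T p.1) (U p.2)).card
  set B2 := Q.filter fun p => 128 * ρ / δ * (t : ℝ) ^ 2 < (splitPairs (U p.2) (T p.1)).card
  set G := Q.filter fun p => δ / 4 * s * t ≤ (edgesBetween E (T p.1) (U p.2)).card with hG
  -- Leftover points cost at most 3δ/8 of all pairs, so the cells hold at least (5δ/8)K²st edges.
  -- Cells of density below δ/4 account for at most (δ/4)K²st of these.
  have hGc : 3 / 8 * δ * (K : ℝ) ^ 2 ≤ G.card := by
    have e1 : ∑ p ∈ Q, ((edgesBetween E (T p.1) (U p.2)).card : ℝ)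
        ≤ G.card * (s * t) + (K : ℝ) ^ 2 * (δ / 4 * s * t) := by
      rw [← Finset.sum_filter_add_sum_filter_not Q
        (fun p => δ / 4 * s * t ≤ (edgesBetween E (T p.1) (U p.2)).card)]
      apply add_le_add
      · rw [← nsmul_eq_mul]
        apply Finset.sum_le_card_nsmul
        intro p hp
        have hp' := hTU p (Finset.mem_filter.1 hp).1
        have := card_edgesBetween_le E (T p.1) (U p.2)
        rw [hp'.1, hp'.2] at this
        exact_mod_cast this
      · rw [← hQc]
        refine (Finset.sum_le_card_nsmul _ _ (δ / 4 * s * t) ?_).trans ?_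
        · intro p hp
          exact (not_le.1 (Finset.mem_filter.1 hp).2).le
        · rw [nsmul_eq_mul]
          apply mul_le_mul_of_nonneg_right _ (by positivity)
          exact_mod_cast Finset.card_le_card (Finset.filter_subset _ _)
    have e2 : ((edgesBetween E A B).card : ℝ) ≤
        4 * ∑ p ∈ Q, ((edgesBetween E (T p.1) (U p.2)).card : ℝ)
        + (A.card - 2 * K * s) * B.card + A.card * (B.card - 2 * K * t) := by
      have : ((edgesBetween E A B).card : ℝ) ≤ ((4 * ∑ p ∈ Q, (edgesBetween E (T p.1) (U p.2)).card
        + (A.card - 2 * K * s) * B.card + A.card * (B.card - 2 * K * t) : ℕ) : ℝ) := by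
        exact_mod_cast hsumE
      push_cast [Nat.cast_sub hsA, Nat.cast_sub htB] at this
      exact this
    have e3 : ((A.card : ℝ) - 2 * K * s) * B.card ≤ 3 / 16 * δ * A.card * B.card :=
      mul_le_mul_of_nonneg_right hs6 (by positivity)
    have e4 : (A.card : ℝ) * (B.card - 2 * K * t) ≤ A.card * (3 / 16 * δ * B.card) :=
      mul_le_mul_of_nonneg_left ht6 (by positivity)
    have e5 : (2 * K * s : ℝ) * (2 * K * t) ≤ A.card * B.card := by
      have a1 : (2 * K * s : ℝ) ≤ A.card := by exact_mod_cast hsA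
      have a2 : (2 * K * t : ℝ) ≤ B.card := by exact_mod_cast htB
      exact mul_le_mul a1 a2 (by positivity) (by positivity)
    have e6 := mul_le_mul_of_nonneg_left e5 hδ.le
    have e7 : 3 / 8 * δ * (K : ℝ) ^ 2 * (s * t) ≤ G.card * (s * t) := by nlinarith
    exact le_of_mul_le_mul_right e7 (by positivity)
  -- 3/8 − 1/8 − 1/8 = 1/8.
  have hPc : δ * (K : ℝ) ^ 2 / 8 ≤ (G \ (B1 ∪ B2)).card := by
    have e1 : G.card ≤ (G \ (B1 ∪ B2)).card + (B1 ∪ B2).card := by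
      have := Finset.le_card_sdiff (B1 ∪ B2) G
      omega
    have e2 := Finset.card_union_le B1 B2
    have e3 : (G.card : ℝ) ≤ (G \ (B1 ∪ B2)).card + B1.card + B2.card := by
      exact_mod_cast (by omega : G.card ≤ (G \ (B1 ∪ B2)).card + B1.card + B2.card)
    linarith
  have hmemQ : ∀ p ∈ G \ (B1 ∪ B2), p ∈ Q := fun p hp =>
    (Finset.mem_filter.1 (Finset.mem_sdiff.1 hp).1).1
  have hQK : ∀ p ∈ Q, p.1 < K ∧ p.2 < K := fun p hp => by
    simpa only [hQ, Finset.mem_product, Finset.mem_range] using hp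
  obtain ⟨I, hI, hIc, hIo⟩ := exists_diagonal (G \ (B1 ∪ B2)) K fun p hp => hQK p (hmemQ p hp)
  refine ⟨I, T, U, ?_, hT, hU, hIo, ?_, ?_, ?_⟩
  · have : ((G \ (B1 ∪ B2)).card : ℝ) ≤ 2 * K * I.card := by exact_mod_cast hIc
    have h2 : (2 * K) * (δ * K / 16) ≤ (2 * K) * (I.card : ℝ) := by nlinarith
    exact le_of_mul_le_mul_left h2 (by positivity)
  · intro p hp q hq hpq
    exact hTo _ _ hpq (hQK q (hmemQ q (hI hq))).1
  · intro p hp q hq hpq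
    exact hUo _ _ hpq (hQK q (hmemQ q (hI hq))).2
  · intro p hp
    have hpQ := hmemQ p (hI hp)
    obtain ⟨c1, c2⟩ := hTU p hpQ
    have hp' := Finset.mem_sdiff.1 (hI hp)
    have hpG := (Finset.mem_filter.1 hp'.1).2
    have hpB := hp'.2
    rw [Finset.mem_union, not_or] at hpB
    rw [c1, c2]
    refine ⟨hs4, ht4, ?_, ?_, hpG⟩
    · by_contra hc
      exact hpB.1 (Finset.mem_filter.2 ⟨hpQ, not_le.1 hc⟩)
    · by_contra hc
      exact hpB.2 (Finset.mem_filter.2 ⟨hpQ, not_le.1 hc⟩)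

/-! ### Crossing families and iteration over levels -/

/-- The endpoints of the segments `p.1 p.2` and `q.1 q.2` form a convex quadrilateral in which
these segments are the diagonals, in a given orientation. -/
def OrientedCross (p q : Plane × Plane) : Prop :=
  0 < orient p.1 q.1 p.2 ∧ 0 < orient p.1 q.1 q.2 ∧ 0 < orient p.2 q.2 p.1 ∧
    0 < orient p.2 q.2 q.1

/-- The four orientations are the coefficients of the affine dependence among the four endpoints, so
after normalisation they are the weights of the common point on both segments; `hsum` makes the two
normalisations agree. -/
theorem OrientedCross.cross {p q : Plane × Plane} (h : OrientedCross p q) :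
    Cross s(p.1, p.2) s(q.1, q.2) := by
  obtain ⟨a, b⟩ := p
  obtain ⟨a', b'⟩ := q
  obtain ⟨hγ, hα, hη, hβ⟩ := h
  simp only at hγ hα hη hβ
  have hsum : orient a a' b' + orient b b' a' = orient a a' b + orient b b' a := by
    unfold orient; ring
  have hpos := add_pos hα hβ
  refine ⟨(orient b b' a' / (orient a a' b' + orient b b' a')) • a
    + (orient a a' b' / (orient a a' b' + orient b b' a')) • b, ?_, ?_⟩
  · exact ⟨_, _, div_pos hβ hpos, div_pos hα hpos, by field_simp; ring, rfl⟩
  · refine ⟨orient b b' a / (orient a a' b' + orient b b' a'),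
      orient a a' b / (orient a a' b' + orient b b' a'), div_pos hη hpos, div_pos hγ hpos, ?_, ?_⟩
    · rw [← add_div, hsum, add_comm, div_self]
      exact (hsum ▸ hpos).ne'
    · ext i
      simp only [PiLp.add_apply, PiLp.smul_apply, smul_eq_mul]
      rw [div_mul_eq_mul_div, div_mul_eq_mul_div, div_mul_eq_mul_div, div_mul_eq_mul_div,
        ← add_div, ← add_div]
      congr 1
      fin_cases i
      · simp only [orient, Fin.zero_eta]; ring
      · simp only [orient, Fin.mk_one]; ring

/-- The existence of at least `F` pairwise crossing segments in `E`, each joining a point of `A`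
to a point of `B`. -/
def HasCrossingFamily (E : Plane → Plane → Prop) (A B : Finset Plane) (F : ℝ) : Prop :=
  ∃ S : Finset (Plane × Plane), S ⊆ edgesBetween E A B ∧
    (∀ p ∈ S, ∀ q ∈ S, p ≠ q → OrientedCross p q ∨ OrientedCross q p) ∧ F ≤ S.card

theorem HasCrossingFamily.mono {E : Plane → Plane → Prop} {A B A' B' : Finset Plane} {F F' : ℝ}
    (h : HasCrossingFamily E A B F) (hA : A ⊆ A') (hB : B ⊆ B') (hF : F' ≤ F) :
    HasCrossingFamily E A' B' F' := by
  obtain ⟨S, h1, h2, h3⟩ := h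
  refine ⟨S, fun p hp => ?_, h2, hF.trans h3⟩
  have := mem_edgesBetween.1 (h1 hp)
  exact mem_edgesBetween.2 ⟨hA this.1, hB this.2.1, this.2.2⟩

theorem hasCrossingFamily_one {E : Plane → Plane → Prop} {A B : Finset Plane}
    (h : (edgesBetween E A B).Nonempty) : HasCrossingFamily E A B 1 := by
  obtain ⟨p, hp⟩ := h
  refine ⟨{p}, by simpa using hp, ?_, by simp⟩
  intro q hq r hr hne
  rw [Finset.mem_singleton] at hq hr
  exact absurd (hq.trans hr.symm) hne

open Classical in
theorem card_edgesBetween_of_forall {E : Plane → Plane → Prop} {A B : Finset Plane}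
    (h : ∀ a ∈ A, ∀ b ∈ B, E a b) : (edgesBetween E A B).card = A.card * B.card := by
  rw [← Finset.card_product, edgesBetween, Finset.filter_true_of_mem]
  intro p hp
  exact h _ (Finset.mem_product.1 hp).1 _ (Finset.mem_product.1 hp).2

-- Induction on the number of levels by `exists_crossing_subpairs`; the common slice orders supply
-- the four signs in `OrientedCross`. The density falls by a factor 4 per level, down to `d` at the
-- bottom. The complete case is separate because there the density stays 1: allowing for the decay
-- would force d ≤ 4^(-t), too costly for the first assertion.
open Classical in
theorem hasCrossingFamily_of_levels {V : Finset Plane} (hV : InGeneralPosition V)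
    (E : Plane → Plane → Prop) (K : ℕ) (hK : 0 < K) (d : ℝ) (hd : 0 < d) (hd1 : d ≤ 1) (t : ℕ) :
    ∀ (A B : Finset Plane) (ρ : ℝ), A ⊆ V → B ⊆ V → LinSep A B → 0 < ρ →
      ρ * (128 / d) ^ t ≤ d / (128 * K) →
      32 / d * (4 * K) ^ t ≤ A.card → 32 / d * (4 * K) ^ t ≤ B.card →
      ((splitPairs A B).card : ℝ) ≤ ρ * (A.card : ℝ) ^ 2 →
      ((splitPairs B A).card : ℝ) ≤ ρ * (B.card : ℝ) ^ 2 →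
      ((∀ a ∈ A, ∀ b ∈ B, E a b) ∨
        d * 4 ^ t * A.card * B.card ≤ (edgesBetween E A B).card) →
      HasCrossingFamily E A B ((d * K / 16) ^ t) := by
  have hK' : (0 : ℝ) < K := by exact_mod_cast hK
  induction t with
  | zero =>
    intro A B ρ hA hB h hρ hρd hmA hmB hAB hBA hE
    rw [pow_zero]
    apply hasCrossingFamily_one
    rw [← Finset.card_pos]
    have hA0 : (0 : ℝ) < A.card := lt_of_lt_of_le (by positivity) hmA
    have hB0 : (0 : ℝ) < B.card := lt_of_lt_of_le (by positivity) hmB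
    rcases hE with hE | hE
    · rw [card_edgesBetween_of_forall hE]
      exact Nat.mul_pos (by exact_mod_cast hA0) (by exact_mod_cast hB0)
    · have : (0 : ℝ) < (edgesBetween E A B).card := lt_of_lt_of_le (by positivity) hE
      exact_mod_cast this
  | succ t ih =>
    intro A B ρ hA hB h hρ hρd hmA hmB hAB hBA hE
    have hA0 : (0 : ℝ) < A.card := lt_of_lt_of_le (by positivity) hmA
    have hB0 : (0 : ℝ) < B.card := lt_of_lt_of_le (by positivity) hmB
    obtain ⟨δ, hdδ, hδ1, hEδ, hE'⟩ : ∃ δ : ℝ, d ≤ δ ∧ δ ≤ 1 ∧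
        δ * A.card * B.card ≤ (edgesBetween E A B).card ∧
        ((∀ a ∈ A, ∀ b ∈ B, E a b) ∨ δ / 4 = d * 4 ^ t) := by
      rcases hE with hE | hE
      · refine ⟨1, hd1, le_rfl, ?_, Or.inl hE⟩
        rw [card_edgesBetween_of_forall hE]
        push_cast; linarith
      · refine ⟨d * 4 ^ (t + 1), ?_, ?_, hE, Or.inr (by ring)⟩
        · exact le_mul_of_one_le_right hd.le (one_le_pow₀ (by norm_num))
        · have h1 : ((edgesBetween E A B).card : ℝ) ≤ A.card * B.card := by
            exact_mod_cast card_edgesBetween_le E A B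
          have h2 : d * 4 ^ (t + 1) * (A.card * B.card) ≤ 1 * (A.card * B.card : ℝ) := by
            linarith
          exact le_of_mul_le_mul_right h2 (by positivity)
    have hδ : 0 < δ := hd.trans_le hdδ
    have hd128 : 1 ≤ 128 / d := by rw [le_div_iff₀ hd]; linarith
    have hK1 : (1 : ℝ) ≤ 4 * K := by
      have : (1 : ℝ) ≤ K := by exact_mod_cast hK
      linarith
    have hρδ : ρ ≤ δ / (64 * K) := by
      calc ρ ≤ ρ * (128 / d) ^ (t + 1) := le_mul_of_one_le_right hρ.le (one_le_pow₀ hd128)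
        _ ≤ d / (128 * K) := hρd
        _ ≤ δ / (64 * K) := by gcongr; norm_num
    have hsize : 32 * K / δ ≤ 32 / d * (4 * K) ^ (t + 1) := by
      calc 32 * K / δ ≤ 32 * K / d := by gcongr
        _ = 32 / d * K := by ring
        _ ≤ 32 / d * (4 * K) ^ (t + 1) := by
          apply mul_le_mul_of_nonneg_left _ (by positivity)
          calc (K : ℝ) ≤ (4 * K) ^ 1 := by linarith
            _ ≤ (4 * K) ^ (t + 1) := pow_le_pow_right₀ hK1 (by omega)
    obtain ⟨I, T, U, hIc, hT, hU, hIo, hTo, hUo, hI⟩ := exists_crossing_subpairs hV hA hB h E K hK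
      δ ρ hδ hδ1 hρ hρδ (hsize.trans hmA) (hsize.trans hmB) hAB hBA hEδ
    have hfam : ∀ p ∈ I, HasCrossingFamily E (T p.1) (U p.2) ((d * K / 16) ^ t) := by
      intro p hp
      obtain ⟨c1, c2, c3, c4, c5⟩ := hI p hp
      have hle : 128 * ρ / δ ≤ 128 * ρ / d := by gcongr
      have hsz : ∀ m : ℕ, 32 / d * (4 * (K : ℝ)) ^ (t + 1) ≤ m →
          32 / d * (4 * (K : ℝ)) ^ t ≤ m / (4 * K) := by
        intro m hm
        rw [le_div_iff₀ (by positivity)]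
        calc _ = 32 / d * (4 * (K : ℝ)) ^ (t + 1) := by ring
          _ ≤ m := hm
      refine ih (T p.1) (U p.2) (128 * ρ / d) ((hT _).trans hA) ((hU _).trans hB)
        (h.mono (hT _) (hU _)) (by positivity) ?_ ((hsz _ hmA).trans c1) ((hsz _ hmB).trans c2)
        (c3.trans (by gcongr)) (c4.trans (by gcongr)) ?_
      · calc _ = ρ * (128 / d) ^ (t + 1) := by ring
          _ ≤ _ := hρd
      · rcases hE' with hE' | hE'
        · exact Or.inl fun a ha b hb => hE' a (hT _ ha) b (hU _ hb)
        · exact Or.inr (hE' ▸ c5)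
    choose! S hS1 hS2 hS3 using hfam
    have hcross : ∀ p ∈ I, ∀ q ∈ I, p.1 < q.1 → p.2 < q.2 → ∀ e ∈ S p, ∀ f ∈ S q,
        OrientedCross e f := by
      intro p hp q hq h1 h2 e he f hf
      have he' := mem_edgesBetween.1 (hS1 p hp he)
      have hf' := mem_edgesBetween.1 (hS1 q hq hf)
      exact ⟨hTo p hp q hq h1 _ he'.1 _ hf'.1 _ (hU _ he'.2.1),
        hTo p hp q hq h1 _ he'.1 _ hf'.1 _ (hU _ hf'.2.1),
        hUo p hp q hq h2 _ he'.2.1 _ hf'.2.1 _ (hT _ he'.1),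
        hUo p hp q hq h2 _ he'.2.1 _ hf'.2.1 _ (hT _ hf'.1)⟩
    have hdisj : ∀ p ∈ I, ∀ q ∈ I, p ≠ q → Disjoint (S p) (S q) := by
      intro p hp q hq hne
      rw [Finset.disjoint_left]
      intro e he he'
      have : OrientedCross e e := by
        rcases hIo p hp q hq hne with h' | h'
        · exact hcross p hp q hq h'.1 h'.2 e he e he'
        · exact hcross q hq p hp h'.1 h'.2 e he' e he
      have h1 := this.1
      rw [orient_self] at h1
      exact lt_irrefl _ h1
    refine ⟨I.biUnion S, ?_, ?_, ?_⟩
    · intro e he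
      obtain ⟨p, hp, he⟩ := Finset.mem_biUnion.1 he
      have := mem_edgesBetween.1 (hS1 p hp he)
      exact mem_edgesBetween.2 ⟨hT _ this.1, hU _ this.2.1, this.2.2⟩
    · intro e he f hf hne
      obtain ⟨p, hp, he⟩ := Finset.mem_biUnion.1 he
      obtain ⟨q, hq, hf⟩ := Finset.mem_biUnion.1 hf
      by_cases hpq : p = q
      · subst hpq
        exact hS2 p hp e he f hf hne
      · rcases hIo p hp q hq hpq with h' | h'
        · exact Or.inl (hcross p hp q hq h'.1 h'.2 e he f hf)
        · exact Or.inr (hcross q hq p hp h'.1 h'.2 f hf e he)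
    · rw [Finset.card_biUnion hdisj]
      push_cast
      have h1 := Finset.card_nsmul_le_sum I (fun p => ((S p).card : ℝ)) _ hS3
      rw [nsmul_eq_mul] at h1
      refine le_trans ?_ h1
      rw [pow_succ, mul_comm]
      apply mul_le_mul_of_nonneg_right _ (by positivity)
      refine le_trans ?_ hIc
      gcongr

/-! ### Large subsets split by few lines -/

/-- A sheared horizontal coordinate. -/
noncomputable def shearCoord (τ : ℝ) (p : Plane) : ℝ := p 0 + τ * p 1

/-- Replaces a rotation to distinct abscissas: each pair of points excludes at most one shear. -/
theorem exists_injOn_shearCoord (V : Finset Plane) : ∃ τ : ℝ, Set.InjOn (shearCoord τ) V := by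
  classical
  set bad : Finset ℝ := (V ×ˢ V).image fun p => (p.2 0 - p.1 0) / (p.1 1 - p.2 1) with hbad
  obtain ⟨τ, hτ⟩ := Infinite.exists_notMem_finset bad
  refine ⟨τ, fun p hp q hq hpq => ?_⟩
  unfold shearCoord at hpq
  by_cases h1 : p 1 = q 1
  · rw [h1] at hpq
    ext i; fin_cases i
    · simpa using hpq
    · exact h1
  · exfalso
    apply hτ
    rw [hbad, Finset.mem_image]
    refine ⟨(p, q), Finset.mem_product.2 ⟨hp, hq⟩, ?_⟩
    have : p 1 - q 1 ≠ 0 := sub_ne_zero.2 h1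
    field_simp
    linarith

theorem shearCoord_slices {X : Finset Plane} {τ : ℝ} (hX : Set.InjOn (shearCoord τ) X)
    (N s : ℕ) (hN : N * s ≤ X.card) :
    ∃ T : ℕ → Finset Plane, (∀ i, T i ⊆ X) ∧ (∀ i < N, (T i).card = s) ∧
      ∀ i j, i < j → ∀ x ∈ T i, ∀ y ∈ T j, shearCoord τ x < shearCoord τ y :=
  exists_slices X (fun x y => shearCoord τ x < shearCoord τ y) (fun _ _ => lt_irrefl _)
    (fun _ _ _ _ _ _ => lt_trans)
    (fun _ hx _ hy hne => lt_or_gt_of_ne fun h => hne (hX hx hy h)) N s hN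

theorem linSep_of_shearCoord {τ : ℝ} {A B : Finset Plane}
    (h : ∀ a ∈ A, ∀ b ∈ B, shearCoord τ a < shearCoord τ b) : LinSep A B :=
  ⟨1, τ, fun a ha b hb => by simpa [shearCoord] using h a ha b hb⟩

/-- Order statistics of finitely many continuous functions are continuous. -/
theorem exists_continuous_orderStatistic {ι : Type*} (X : Finset ι) (f : ι → ℝ → ℝ)
    (hf : ∀ i, Continuous (f i)) (k : ℕ) (hk : 0 < k) (hkX : k ≤ X.card) :
    ∃ g : ℝ → ℝ, Continuous g ∧ ∀ s,
      (∃ i ∈ X, g s = f i s) ∧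
      (∃ T ⊆ X, T.card = k ∧ ∀ i ∈ T, f i s ≤ g s) ∧
      (∃ T ⊆ X, T.card = X.card + 1 - k ∧ ∀ i ∈ T, g s ≤ f i s) := by
  classical
  have hne : (X.powersetCard k).attach.Nonempty := by
    rw [Finset.attach_nonempty_iff]; exact Finset.powersetCard_nonempty.2 hkX
  have hT : ∀ T : {T // T ∈ X.powersetCard k}, T.1.Nonempty := fun T =>
    Finset.card_pos.1 (by rw [(Finset.mem_powersetCard.1 T.2).2]; exact hk)
  -- The `k`-th smallest value is the minimum over `k`-subsets of their maximum, a form in which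
  -- continuity is evident.
  refine ⟨fun s => (X.powersetCard k).attach.inf' hne fun T => T.1.sup' (hT T) fun i => f i s,
    ?_, ?_⟩
  · apply Continuous.finset_inf'_apply
    intro T _
    apply Continuous.finset_sup'_apply
    intro i _
    exact hf i
  · intro s
    obtain ⟨T, -, hTe⟩ := Finset.exists_mem_eq_inf' hne
      (fun T : {T // T ∈ X.powersetCard k} => T.1.sup' (hT T) fun i => f i s)
    obtain ⟨i, hi, hie⟩ := Finset.exists_mem_eq_sup' (hT T) fun i => f i s
    have hTX := Finset.mem_powersetCard.1 T.2
    refine ⟨⟨i, hTX.1 hi, hTe.trans hie⟩, ⟨T.1, hTX.1, hTX.2, ?_⟩, ?_⟩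
    · intro j hj
      simp only [hTe]
      exact Finset.le_sup' (fun i => f i s) hj
    · set c := (X.powersetCard k).attach.inf' hne fun T => T.1.sup' (hT T) fun i => f i s with hc
      have hlow : (X.filter fun i => f i s < c).card < k := by
        by_contra hcon
        obtain ⟨T', hT', hT'c⟩ := Finset.exists_subset_card_eq (not_lt.1 hcon)
        have hmem : T' ∈ X.powersetCard k :=
          Finset.mem_powersetCard.2 ⟨hT'.trans (Finset.filter_subset _ _), hT'c⟩
        have h1 : c ≤ T'.sup' (hT ⟨T', hmem⟩) fun i => f i s :=
          Finset.inf'_le (fun T : {T // T ∈ X.powersetCard k} => T.1.sup' (hT T) fun i => f i s)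
            (Finset.mem_attach _ ⟨T', hmem⟩)
        have h2 : T'.sup' (hT ⟨T', hmem⟩) (fun i => f i s) < c := by
          rw [Finset.sup'_lt_iff]
          intro j hj
          exact (Finset.mem_filter.1 (hT' hj)).2
        exact absurd h1 (not_le.2 h2)
      have hadd := Finset.card_filter_add_card_filter_not (s := X) (fun i => f i s < c)
      obtain ⟨T', hT', hT'c⟩ := Finset.exists_subset_card_eq
        (show X.card + 1 - k ≤ (X.filter fun i => ¬ f i s < c).card by omega)
      exact ⟨T', hT'.trans (Finset.filter_subset _ _), hT'c, fun j hj =>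
        not_lt.1 (Finset.mem_filter.1 (hT' hj)).2⟩

/-- A line which splits `Y` meets the convex hull of `Y`. -/
theorem Splits.exists_point {Y : Finset Plane} {p q : Plane} (h : Splits Y p q) :
    ∃ z : Plane, orient p q z = 0 ∧
      ∀ u v : ℝ, ∃ y ∈ Y, u * z 0 + v * z 1 ≤ u * y 0 + v * y 1 := by
  obtain ⟨⟨b, hb, h1⟩, ⟨b', hb', h2⟩⟩ := h
  obtain ⟨α, β, hα, hβ, hαβ, hw⟩ : ∃ α β : ℝ, 0 ≤ α ∧ 0 ≤ β ∧ α + β = 1 ∧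
      α * orient p q b + β * orient p q b' = 0 := by
    have hs : 0 < orient p q b + -orient p q b' := by linarith
    refine ⟨-orient p q b' / (orient p q b + -orient p q b'),
      orient p q b / (orient p q b + -orient p q b'), div_nonneg (by linarith) hs.le,
      div_nonneg h1.le hs.le, ?_, ?_⟩
    · rw [← add_div, add_comm, div_self hs.ne']
    · ring
  have hz0 : ∀ i, (α • b + β • b') i = α * b i + β * b' i := fun i => by simp
  refine ⟨α • b + β • b', ?_, fun u v => ?_⟩
  · rw [← hw]
    simp only [orient, hz0]
    linear_combination ((q 0 - p 0) * p 1 - (q 1 - p 1) * p 0) * hαβ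
  · rw [hz0, hz0]
    rcases le_total (u * b 0 + v * b 1) (u * b' 0 + v * b' 1) with h | h
    · refine ⟨b', hb', ?_⟩
      have := mul_le_mul_of_nonneg_left h hα
      have e : u * b' 0 + v * b' 1 = (α + β) * (u * b' 0 + v * b' 1) := by rw [hαβ, one_mul]
      rw [e]; linarith
    · refine ⟨b, hb, ?_⟩
      have := mul_le_mul_of_nonneg_left h hβ
      have e : u * b 0 + v * b 1 = (α + β) * (u * b 0 + v * b 1) := by rw [hαβ, one_mul]
      rw [e]; linarith

/-- The line would meet the three convex hulls in points ordered by `shearCoord`, with the middle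
one strictly on one side of the line at level `c` and the outer two not on that side. The middle
point lies between the outer ones, a contradiction. -/
theorem not_splits_three {L M R : Finset Plane} {τ μ ν c : ℝ}
    (hLM : ∀ x ∈ L, ∀ y ∈ M, shearCoord τ x < shearCoord τ y)
    (hMR : ∀ x ∈ M, ∀ y ∈ R, shearCoord τ x < shearCoord τ y)
    (hL : ∀ x ∈ L, μ * x 1 + ν * shearCoord τ x ≤ c)
    (hM : ∀ x ∈ M, c < μ * x 1 + ν * shearCoord τ x)
    (hR : ∀ x ∈ R, μ * x 1 + ν * shearCoord τ x ≤ c) (p q : Plane) :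
    ¬ (Splits L p q ∧ Splits M p q ∧ Splits R p q) := by
  rintro ⟨h1, h2, h3⟩
  have hne := h1.ne
  obtain ⟨z1, o1, g1⟩ := h1.exists_point
  obtain ⟨z2, o2, g2⟩ := h2.exists_point
  obtain ⟨z3, o3, g3⟩ := h3.exists_point
  unfold shearCoord at *
  have x12 : z1 0 + τ * z1 1 < z2 0 + τ * z2 1 := by
    obtain ⟨a, ha, ha'⟩ := g1 1 τ
    obtain ⟨b, hb, hb'⟩ := g2 (-1) (-τ)
    have := hLM a ha b hb
    linarith
  have x23 : z2 0 + τ * z2 1 < z3 0 + τ * z3 1 := by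
    obtain ⟨a, ha, ha'⟩ := g2 1 τ
    obtain ⟨b, hb, hb'⟩ := g3 (-1) (-τ)
    have := hMR a ha b hb
    linarith
  have k1 : μ * z1 1 + ν * (z1 0 + τ * z1 1) ≤ c := by
    obtain ⟨a, ha, ha'⟩ := g1 ν (μ + ν * τ)
    have := hL a ha
    linarith
  have k3 : μ * z3 1 + ν * (z3 0 + τ * z3 1) ≤ c := by
    obtain ⟨a, ha, ha'⟩ := g3 ν (μ + ν * τ)
    have := hR a ha
    linarith
  have k2 : c < μ * z2 1 + ν * (z2 0 + τ * z2 1) := by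
    obtain ⟨a, ha, ha'⟩ := g2 (-ν) (-(μ + ν * τ))
    have := hM a ha
    linarith
  unfold orient at o1 o2 o3
  set x1 := z1 0 + τ * z1 1 with hx1
  set x2 := z2 0 + τ * z2 1 with hx2
  set x3 := z3 0 + τ * z3 1 with hx3
  set β := (q 0 - p 0) + (q 1 - p 1) * τ with hβ
  have e12 : β * (z2 1 - z1 1) = (q 1 - p 1) * (x2 - x1) := by
    rw [hβ, hx1, hx2]; linear_combination o2 - o1
  have e23 : β * (z3 1 - z2 1) = (q 1 - p 1) * (x3 - x2) := by
    rw [hβ, hx2, hx3]; linear_combination o3 - o2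
  by_cases hβ0 : β = 0
  · rw [hβ0, zero_mul] at e12
    have hq1 : q 1 - p 1 = 0 :=
      (mul_eq_zero.1 e12.symm).resolve_right (sub_pos.2 x12).ne'
    rw [hq1, zero_mul, add_zero] at hβ
    apply hne
    ext i; fin_cases i
    · simp only [Fin.zero_eta]; linarith
    · simp only [Fin.mk_one]; linarith
  · have e : (z2 1 - z1 1) * (x3 - x2) = (z3 1 - z2 1) * (x2 - x1) := by
      apply mul_left_cancel₀ hβ0
      linear_combination (x3 - x2) * e12 - (x2 - x1) * e23
    have m1 := mul_le_mul_of_nonneg_left k1 (sub_pos.2 x23).le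
    have m3 := mul_le_mul_of_nonneg_left k3 (sub_pos.2 x12).le
    have m2 := mul_lt_mul_of_pos_left k2 (sub_pos.2 (x12.trans x23))
    have : (x3 - x1) * (μ * z2 1 + ν * x2)
        = (x3 - x2) * (μ * z1 1 + ν * x1) + (x2 - x1) * (μ * z3 1 + ν * x3) := by
      linear_combination μ * e
    linarith

open Classical in
/-- Every point set contains three subsets of linear size which are not split by a common line. -/
theorem exists_three_subsets {V X : Finset Plane} (hV : InGeneralPosition V) (hXV : X ⊆ V) {τ : ℝ}
    (hτ : Set.InjOn (shearCoord τ) V) (hX : 4 ≤ X.card) :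
    ∃ X₁ X₂ X₃ : Finset Plane, X₁ ⊆ X ∧ X₂ ⊆ X ∧ X₃ ⊆ X ∧ X.card ≤ 16 * X₁.card ∧
      X.card ≤ 16 * X₂.card ∧ X.card ≤ 16 * X₃.card ∧
      ∀ p q, ¬ (Splits X₁ p q ∧ Splits X₂ p q ∧ Splits X₃ p q) := by
  set m := X.card / 3 with hm
  obtain ⟨T, hT1, hT2, hT3⟩ := shearCoord_slices (hτ.mono (Finset.coe_subset.2 hXV)) 3 m (by omega)
  set f : Plane → ℝ → ℝ := fun p s => p 1 - s * shearCoord τ p with hf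
  have hfc : ∀ p, Continuous (f p) := fun p => by simp only [hf]; fun_prop
  have hL := hT2 0 (by norm_num)
  have hM := hT2 1 (by norm_num)
  have hR := hT2 2 (by norm_num)
  obtain ⟨g, hgc, hg⟩ := exists_continuous_orderStatistic (T 0) f hfc ((m + 1) / 2) (by omega)
    (by omega)
  obtain ⟨g', hgc', hg'⟩ := exists_continuous_orderStatistic (T 2) f hfc ((m + 1) / 2) (by omega)
    (by omega)
  have hLR : ∀ x ∈ T 0, ∀ y ∈ T 2, 0 < shearCoord τ y - shearCoord τ x := fun x hx y hy =>
    sub_pos.2 (hT3 0 2 (by norm_num) x hx y hy)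
  -- `f p s` is the intercept of the line of slope `s` through `p`. The median intercepts of the two
  -- outer thirds compare in opposite ways for extreme slopes, so by continuity some line bisects
  -- both thirds.
  have hpos : ∃ s, 0 ≤ g s - g' s := by
    have : ∀ᶠ s : ℝ in Filter.atTop, ∀ x ∈ T 0, ∀ y ∈ T 2,
        (y 1 - x 1) / (shearCoord τ y - shearCoord τ x) ≤ s := by
      simp only [Finset.eventually_all]
      exact fun x _ y _ => Filter.eventually_ge_atTop _
    obtain ⟨s, hs⟩ := this.exists
    obtain ⟨⟨x, hx, hx'⟩, -⟩ := hg s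
    obtain ⟨⟨y, hy, hy'⟩, -⟩ := hg' s
    refine ⟨s, ?_⟩
    have := hs x hx y hy
    rw [div_le_iff₀ (hLR x hx y hy)] at this
    rw [hx', hy']
    simp only [hf]; linarith
  have hneg : ∃ s, g s - g' s ≤ 0 := by
    have : ∀ᶠ s : ℝ in Filter.atBot, ∀ x ∈ T 0, ∀ y ∈ T 2,
        s ≤ (y 1 - x 1) / (shearCoord τ y - shearCoord τ x) := by
      simp only [Finset.eventually_all]
      exact fun x _ y _ => Filter.eventually_le_atBot _
    obtain ⟨s, hs⟩ := this.exists
    obtain ⟨⟨x, hx, hx'⟩, -⟩ := hg s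
    obtain ⟨⟨y, hy, hy'⟩, -⟩ := hg' s
    refine ⟨s, ?_⟩
    have := hs x hx y hy
    rw [le_div_iff₀ (hLR x hx y hy)] at this
    rw [hx', hy']
    simp only [hf]; linarith
  obtain ⟨s, hs⟩ := mem_range_of_exists_le_of_exists_ge (hgc.sub hgc') hneg hpos
  have hs' : g' s = g s := (sub_eq_zero.1 hs).symm
  obtain ⟨⟨x, hx, hxc⟩, ⟨L₁, hL₁, hL₁c, hL₁f⟩, ⟨L₂, hL₂, hL₂c, hL₂f⟩⟩ := hg s
  obtain ⟨⟨y, hy, hyc⟩, ⟨R₁, hR₁, hR₁c, hR₁f⟩, ⟨R₂, hR₂, hR₂c, hR₂f⟩⟩ := hg' s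
  rw [hs'] at hyc hR₁f hR₂f
  set c := g s
  -- The bisecting line already contains `x` and `y` from the outer thirds, so general position
  -- keeps it off the middle third.
  have hMc : ∀ z ∈ T 1, f z s ≠ c := by
    intro z hz hzc
    have h1 := hT3 0 1 (by norm_num) x hx z hz
    have h2 := hT3 1 2 (by norm_num) z hz y hy
    refine hV.orient_ne_zero (hXV (hT1 _ hx)) (hXV (hT1 _ hz)) (hXV (hT1 _ hy)) ?_ ?_ ?_ ?_
    · rintro rfl; exact lt_irrefl _ h1
    · rintro rfl; exact lt_irrefl _ (h1.trans h2)
    · rintro rfl; exact lt_irrefl _ h2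
    · simp only [hf] at hxc hyc hzc
      have e1 : z 1 = x 1 + s * (shearCoord τ z - shearCoord τ x) := by linarith
      have e2 : y 1 = x 1 + s * (shearCoord τ y - shearCoord τ x) := by linarith
      have : orient x z y = (shearCoord τ z - shearCoord τ x) * (y 1 - x 1)
          - (z 1 - x 1) * (shearCoord τ y - shearCoord τ x) := by
        simp only [orient, shearCoord]; ring
      rw [this, e1, e2]; ring
  have hsplit : (T 1).card ≤ ((T 1).filter fun z => c < f z s).card
      + ((T 1).filter fun z => f z s < c).card := by
    refine (Finset.card_le_card fun z hz => ?_).trans (Finset.card_union_le _ _)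
    rw [Finset.mem_union, Finset.mem_filter, Finset.mem_filter]
    rcases lt_or_gt_of_ne (hMc z hz) with h | h
    · exact Or.inr ⟨hz, h⟩
    · exact Or.inl ⟨hz, h⟩
  have hsub : ∀ {i} {Y : Finset Plane}, Y ⊆ T i → Y ⊆ X := fun h => h.trans (hT1 _)
  have hLM : ∀ {Y Z}, Y ⊆ T 0 → Z ⊆ T 1 → ∀ x ∈ Y, ∀ y ∈ Z, shearCoord τ x < shearCoord τ y :=
    fun h h' x hx y hy => hT3 0 1 (by norm_num) x (h hx) y (h' hy)
  have hMR : ∀ {Y Z}, Y ⊆ T 1 → Z ⊆ T 2 → ∀ x ∈ Y, ∀ y ∈ Z, shearCoord τ x < shearCoord τ y :=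
    fun h h' x hx y hy => hT3 1 2 (by norm_num) x (h hx) y (h' hy)
  -- The majority side of the middle third is combined with the opposite closed halves of the outer
  -- thirds.
  by_cases hcase : m ≤ 2 * ((T 1).filter fun z => c < f z s).card
  · refine ⟨L₁, (T 1).filter fun z => c < f z s, R₁, hsub hL₁, hsub (Finset.filter_subset _ _),
      hsub hR₁, by omega, by omega, by omega, ?_⟩
    refine not_splits_three (τ := τ) (μ := 1) (ν := -s) (c := c)
      (hLM hL₁ (Finset.filter_subset _ _)) (hMR (Finset.filter_subset _ _) hR₁) ?_ ?_ ?_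
    · intro x hx; have := hL₁f x hx; simp only [hf] at this; linarith
    · intro x hx; have := (Finset.mem_filter.1 hx).2; simp only [hf] at this; linarith
    · intro x hx; have := hR₁f x hx; simp only [hf] at this; linarith
  · refine ⟨L₂, (T 1).filter fun z => f z s < c, R₂, hsub hL₂, hsub (Finset.filter_subset _ _),
      hsub hR₂, by omega, by omega, by omega, ?_⟩
    refine not_splits_three (τ := τ) (μ := -1) (ν := s) (c := -c)
      (hLM hL₂ (Finset.filter_subset _ _)) (hMR (Finset.filter_subset _ _) hR₂) ?_ ?_ ?_
    · intro x hx; have := hL₂f x hx; simp only [hf] at this; linarith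
    · intro x hx; have := (Finset.mem_filter.1 hx).2; simp only [hf] at this; linarith
    · intro x hx; have := hR₂f x hx; simp only [hf] at this; linarith

open Classical in
/-- Every point set has a large subset which is split by few of a given set of lines. -/
theorem exists_rarely_split {V : Finset Plane} (hV : InGeneralPosition V) {τ : ℝ}
    (hτ : Set.InjOn (shearCoord τ) V) (t : ℕ) :
    ∀ (X : Finset Plane) (Q : Finset (Plane × Plane)), X ⊆ V → 16 ^ t ≤ X.card →
      ∃ Y ⊆ X, X.card ≤ 16 ^ t * Y.card ∧
        3 ^ t * (Q.filter fun e => Splits Y e.1 e.2).card ≤ 2 ^ t * Q.card := by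
  induction t with
  | zero =>
    intro X Q hX hXc
    exact ⟨X, subset_rfl, by simp, by simpa using Finset.card_le_card (Finset.filter_subset _ _)⟩
  | succ t ih =>
    intro X Q hX hXc
    have h16 : 16 * 16 ^ t ≤ X.card := by rw [pow_succ] at hXc; omega
    have hpos : 0 < 16 ^ t := by positivity
    obtain ⟨X₁, X₂, X₃, s1, s2, s3, c1, c2, c3, hno⟩ :=
      exists_three_subsets hV hX hτ (by omega)
    -- Each line splits at most two of the three sets.
    have hsum : (Q.filter fun e => Splits X₁ e.1 e.2).card
        + (Q.filter fun e => Splits X₂ e.1 e.2).card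
        + (Q.filter fun e => Splits X₃ e.1 e.2).card ≤ 2 * Q.card := by
      simp only [Finset.card_filter]
      rw [← Finset.sum_add_distrib, ← Finset.sum_add_distrib, mul_comm, ← smul_eq_mul]
      apply Finset.sum_le_card_nsmul
      intro e _
      have := hno e.1 e.2
      split_ifs <;> simp_all
    obtain ⟨X', s', c', hQ'⟩ : ∃ X' ⊆ X, X.card ≤ 16 * X'.card ∧
        3 * (Q.filter fun e => Splits X' e.1 e.2).card ≤ 2 * Q.card := by
      by_contra hcon
      push Not at hcon
      have h1 := hcon X₁ s1 c1
      have h2 := hcon X₂ s2 c2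
      have h3 := hcon X₃ s3 c3
      omega
    obtain ⟨Y, hY, hYc, hYQ⟩ := ih X' (Q.filter fun e => Splits X' e.1 e.2) (s'.trans hX) (by omega)
    refine ⟨Y, hY.trans s', ?_, ?_⟩
    · calc X.card ≤ 16 * X'.card := c'
        _ ≤ 16 * (16 ^ t * Y.card) := Nat.mul_le_mul_left _ hYc
        _ = 16 ^ (t + 1) * Y.card := by ring
    · have heq : (Q.filter fun e => Splits X' e.1 e.2).filter (fun e => Splits Y e.1 e.2)
          = Q.filter fun e => Splits Y e.1 e.2 := by
        rw [Finset.filter_filter]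
        exact Finset.filter_congr fun e _ => ⟨fun h => h.2, fun h => ⟨h.mono hY, h⟩⟩
      rw [heq] at hYQ
      calc 3 ^ (t + 1) * (Q.filter fun e => Splits Y e.1 e.2).card
          = 3 * (3 ^ t * (Q.filter fun e => Splits Y e.1 e.2).card) := by ring
        _ ≤ 3 * (2 ^ t * (Q.filter fun e => Splits X' e.1 e.2).card) :=
          Nat.mul_le_mul_left _ hYQ
        _ = 2 ^ t * (3 * (Q.filter fun e => Splits X' e.1 e.2).card) := by ring
        _ ≤ 2 ^ t * (2 * Q.card) := Nat.mul_le_mul_left _ hQ'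
        _ = 2 ^ (t + 1) * Q.card := by ring

/-! ### Making split pairs rare without losing density -/

open Classical in
theorem exists_rarely_split_pairs {V X Y : Finset Plane} (hV : InGeneralPosition V) {τ : ℝ}
    (hτ : Set.InjOn (shearCoord τ) V) (hX : X ⊆ V) (t : ℕ) (hXc : 16 ^ t ≤ X.card) :
    ∃ X' ⊆ X, X.card ≤ 16 ^ t * X'.card ∧
      3 ^ t * (splitPairs Y X').card ≤ 2 ^ t * Y.card ^ 2 := by
  obtain ⟨X', h1, h2, h3⟩ := exists_rarely_split hV hτ t X (Y ×ˢ Y) hX hXc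
  refine ⟨X', h1, h2, ?_⟩
  rw [Finset.card_product, ← sq] at h3
  exact h3

open Classical in
theorem card_edgesBetween_swap (E : Plane → Plane → Prop) (A B : Finset Plane) :
    (edgesBetween (fun b a => E a b) B A).card = (edgesBetween E A B).card := by
  refine Finset.card_nbij' Prod.swap Prod.swap ?_ ?_ (fun _ _ => rfl) (fun _ _ => rfl)
  · intro p hp
    rw [Finset.mem_coe, mem_edgesBetween] at hp ⊢
    exact ⟨hp.2.1, hp.1, hp.2.2⟩
  · intro p hp
    rw [Finset.mem_coe, mem_edgesBetween] at hp ⊢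
    exact ⟨hp.2.1, hp.1, hp.2.2⟩

open Classical in
theorem card_edgesBetween_eq_sum (E : Plane → Plane → Prop) (A B : Finset Plane) :
    (edgesBetween E A B).card = ∑ b ∈ B, (A.filter fun a => E a b).card := by
  simp only [edgesBetween, Finset.card_filter]
  rw [Finset.sum_product_right]

open Classical in
/-- A dense bipartite graph has many vertices of high degree. -/
theorem exists_high_degree (E : Plane → Plane → Prop) (A B : Finset Plane) (hA : A.Nonempty)
    {δ : ℝ} (hδ : 0 ≤ δ) (hE : δ * A.card * B.card ≤ (edgesBetween E A B).card) :
    ∃ B' ⊆ B, δ / 2 * B.card ≤ B'.card ∧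
      ∀ C ⊆ B', δ / 2 * A.card * C.card ≤ (edgesBetween E A C).card := by
  have hA0 : (0 : ℝ) < A.card := by exact_mod_cast hA.card_pos
  set B' := B.filter fun b => δ / 2 * A.card ≤ (A.filter fun a => E a b).card with hB'
  refine ⟨B', Finset.filter_subset _ _, ?_, ?_⟩
  · have h1 : ((edgesBetween E A B).card : ℝ) ≤ B'.card * A.card + B.card * (δ / 2 * A.card) := by
      rw [card_edgesBetween_eq_sum]
      push_cast
      rw [← Finset.sum_filter_add_sum_filter_not B
        (fun b => δ / 2 * A.card ≤ (A.filter fun a => E a b).card)]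
      apply add_le_add
      · rw [← nsmul_eq_mul]
        apply Finset.sum_le_card_nsmul
        intro b _
        exact_mod_cast Finset.card_le_card (Finset.filter_subset _ _)
      · refine (Finset.sum_le_card_nsmul _ _ (δ / 2 * A.card) ?_).trans ?_
        · intro b hb
          exact (not_le.1 (Finset.mem_filter.1 hb).2).le
        · rw [nsmul_eq_mul]
          apply mul_le_mul_of_nonneg_right _ (by positivity)
          exact_mod_cast Finset.card_le_card (Finset.filter_subset _ _)
    have h2 : (δ / 2 * B.card) * A.card ≤ B'.card * (A.card : ℝ) := by linarith
    exact le_of_mul_le_mul_right h2 hA0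
  · intro C hC
    rw [card_edgesBetween_eq_sum]
    push_cast
    have := Finset.card_nsmul_le_sum C (fun b => ((A.filter fun a => E a b).card : ℝ))
      (δ / 2 * A.card) (fun b hb => (Finset.mem_filter.1 (hC hb)).2)
    rw [nsmul_eq_mul] at this
    linarith

theorem splitPairs_mono {X X' Y Y' : Finset Plane} (hX : X ⊆ X') (hY : Y ⊆ Y') :
    splitPairs X Y ⊆ splitPairs X' Y' := by
  intro p hp
  rw [mem_splitPairs] at hp ⊢
  exact ⟨hX hp.1, hX hp.2.1, hp.2.2.mono hY⟩

/-- Passing to large subsets which see each other in nearly constant orders, without losing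
density. -/
theorem exists_subpair_rarely_split {V A B : Finset Plane} (hV : InGeneralPosition V) {τ : ℝ}
    (hτ : Set.InjOn (shearCoord τ) V) (hA : A ⊆ V) (hB : B ⊆ V) (E : Plane → Plane → Prop)
    {δ : ℝ} (hδ : 0 < δ) (t₁ t₂ : ℕ) (ht₁ : 16 ^ t₁ ≤ δ / 2 * B.card)
    (ht₂ : 16 ^ t₂ ≤ δ / 4 * A.card)
    (hE : δ * A.card * B.card ≤ (edgesBetween E A B).card) :
    ∃ A' ⊆ A, ∃ B' ⊆ B, δ / 4 * A.card ≤ 16 ^ t₂ * A'.card ∧ δ / 2 * B.card ≤ 16 ^ t₁ * B'.card ∧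
      3 ^ t₁ * (splitPairs A' B').card ≤ 2 ^ t₁ * A.card ^ 2 ∧
      3 ^ t₂ * (splitPairs B' A').card ≤ 2 ^ t₂ * B'.card ^ 2 ∧
      δ / 4 * A'.card * B'.card ≤ (edgesBetween E A' B').card := by
  have hA0 : (0 : ℝ) < A.card := by
    have : (0 : ℝ) < δ / 4 * A.card := lt_of_lt_of_le (by positivity) ht₂
    exact (mul_pos_iff_of_pos_left (by positivity)).1 this
  have hAne : A.Nonempty := Finset.card_pos.1 (by exact_mod_cast hA0)
  -- Restricting to vertices of high degree first lets the set be shrunk arbitrarily without losing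
  -- density. `B` is treated before `A` shrinks, so the first split bound stays relative to
  -- `A.card`.
  obtain ⟨B₁, hB₁, hB₁c, hB₁E⟩ := exists_high_degree E A B hAne hδ.le hE
  obtain ⟨B', hB', hB'c, hB's⟩ := exists_rarely_split_pairs (Y := A) hV hτ (hB₁.trans hB) t₁
    (by exact_mod_cast ht₁.trans hB₁c)
  have hB'c' : (B₁.card : ℝ) ≤ 16 ^ t₁ * B'.card := by exact_mod_cast hB'c
  have hB'0 : (0 : ℝ) < B'.card := by
    have : (0 : ℝ) < 16 ^ t₁ * B'.card := lt_of_lt_of_le (by positivity)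
      (ht₁.trans (hB₁c.trans hB'c'))
    exact (mul_pos_iff_of_pos_left (by positivity)).1 this
  have hB'ne : B'.Nonempty := Finset.card_pos.1 (by exact_mod_cast hB'0)
  have hE' := hB₁E B' hB'
  obtain ⟨A₁, hA₁, hA₁c, hA₁E⟩ := exists_high_degree (fun b a => E a b) B' A hB'ne
    (δ := δ / 2) (by positivity) (by rw [card_edgesBetween_swap]; linarith)
  have h4 : δ / 2 / 2 = δ / 4 := by ring
  rw [h4] at hA₁c hA₁E
  obtain ⟨A', hA', hA'c, hA's⟩ := exists_rarely_split_pairs (Y := B') hV hτ (hA₁.trans hA) t₂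
    (by exact_mod_cast ht₂.trans hA₁c)
  have hA'c' : (A₁.card : ℝ) ≤ 16 ^ t₂ * A'.card := by exact_mod_cast hA'c
  refine ⟨A', hA'.trans hA₁, B', hB'.trans hB₁, hA₁c.trans hA'c', hB₁c.trans hB'c', ?_, hA's, ?_⟩
  · refine le_trans (Nat.mul_le_mul_left _ (Finset.card_le_card ?_)) hB's
    exact splitPairs_mono (hA'.trans hA₁) subset_rfl
  · have := hA₁E A' hA'
    rw [card_edgesBetween_swap] at this
    linarith

/-! ### The estimate for separated sets -/

/-- Since 9 ≥ 8, two reductions by 2/3 at least halve. -/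
theorem two_pow_mul_le_of_three_pow {j c N : ℕ} (h : 3 ^ (2 * j) * c ≤ 2 ^ (2 * j) * N) :
    2 ^ j * c ≤ N := by
  have h1 : (2 ^ (2 * j)) * (2 ^ j * c) ≤ 2 ^ (2 * j) * N := by
    refine le_trans ?_ h
    rw [← mul_assoc]
    apply Nat.mul_le_mul_right
    rw [pow_mul, pow_mul, ← mul_pow]
    exact Nat.pow_le_pow_left (by norm_num) j
  exact Nat.le_of_mul_le_mul_left h1 (by positivity)

/-- Selects the depth of the recursion: as many of the `D` levels as the set sizes permit. -/
theorem exists_last_le (P : ℕ → Prop) (h0 : P 0) (D : ℕ) :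
    ∃ t ≤ D, P t ∧ (t = D ∨ ¬ P (t + 1)) := by
  induction D with
  | zero => exact ⟨0, le_rfl, h0, Or.inl rfl⟩
  | succ D ih =>
    obtain ⟨t, ht, hP, h | h⟩ := ih
    · subst h
      by_cases h' : P (t + 1)
      · exact ⟨t + 1, le_rfl, h', Or.inl rfl⟩
      · exact ⟨t, by omega, hP, Or.inr h'⟩
    · exact ⟨t, by omega, hP, Or.inr h⟩

/-- The main estimate for two separated point sets, with `D` levels of branching `2 ^ k`. -/
theorem hasCrossingFamily_of_dense {V A B : Finset Plane} (hV : InGeneralPosition V) {τ : ℝ}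
    (hτ : Set.InjOn (shearCoord τ) V) (hA : A ⊆ V) (hB : B ⊆ V) (h : LinSep A B)
    (E : Plane → Plane → Prop) (D k u m R : ℕ) (hR : (7 + u) * (D + 1) + k ≤ R)
    (hmA : m ≤ A.card) (hmB : m ≤ B.card) (hmk : m ≤ 2 ^ (k * D))
    (hE : (∀ a ∈ A, ∀ b ∈ B, E a b) ∨
      4 * (1 / 2 ^ u) * 4 ^ D * A.card * B.card ≤ ((edgesBetween E A B).card : ℝ)) :
    HasCrossingFamily E A B ((m : ℝ) / 2 ^ (180 * R)) := by
  rcases Nat.eq_zero_or_pos m with rfl | hm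
  · exact ⟨∅, by simp, by simp, by simp⟩
  have hm0 : (0 : ℝ) < m := by exact_mod_cast hm
  have hmA' : (m : ℝ) ≤ A.card := by exact_mod_cast hmA
  have hmB' : (m : ℝ) ≤ B.card := by exact_mod_cast hmB
  have hA0 := hm0.trans_le hmA'
  have hB0 := hm0.trans_le hmB'
  set d : ℝ := 1 / 2 ^ u with hd
  have hd0 : 0 < d := by positivity
  have hdu : d * 2 ^ u = 1 := by rw [hd]; field_simp
  have hd1 : d ≤ 1 := by
    rw [hd, div_le_one (by positivity)]; exact one_le_pow₀ (by norm_num)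
  have hRu : 7 * D + u * D + 7 + u + k ≤ R := by
    have : (7 + u) * (D + 1) = 7 * D + u * D + 7 + u := by ring
    omega
  obtain ⟨δ, hdδ, hEδ, hE'⟩ : ∃ δ : ℝ, d ≤ δ ∧
      δ * A.card * B.card ≤ (edgesBetween E A B).card ∧
      ((∀ a ∈ A, ∀ b ∈ B, E a b) ∨ δ / 4 = d * 4 ^ D) := by
    rcases hE with hE | hE
    · refine ⟨1, hd1, ?_, Or.inl hE⟩
      rw [card_edgesBetween_of_forall hE]
      push_cast; linarith
    · refine ⟨4 * d * 4 ^ D, ?_, hE, Or.inr (by ring)⟩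
      have : (1 : ℝ) ≤ 4 ^ D := one_le_pow₀ (by norm_num)
      nlinarith
  have hδ0 : 0 < δ := hd0.trans_le hdδ
  by_cases hsmall : m ≤ 2 ^ (180 * R)
  · apply (hasCrossingFamily_one _).mono subset_rfl subset_rfl
    · rw [div_le_one (by positivity)]; exact_mod_cast hsmall
    · rw [← Finset.card_pos]
      have : (0 : ℝ) < (edgesBetween E A B).card := lt_of_lt_of_le (by positivity) hEδ
      exact_mod_cast this
  have hbig : (2 : ℝ) ^ (180 * R) ≤ m := by exact_mod_cast (not_le.1 hsmall).le
  have two_le : ∀ {a b : ℕ}, a ≤ b → (2 : ℝ) ^ a ≤ 2 ^ b := fun h =>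
    pow_le_pow_right₀ (by norm_num) h
  have h16 : ∀ j : ℕ, (16 : ℝ) ^ j = 2 ^ (4 * j) := fun j => by rw [pow_mul]; norm_num
  -- `δ` times anything beats `2 ^ (-u)` times it
  have hδu : ∀ x : ℝ, 0 ≤ x → x ≤ 2 ^ u * (δ * x) := fun x hx => by
    have := mul_le_mul_of_nonneg_right hdδ (show 0 ≤ 2 ^ u * x by positivity)
    calc x = d * (2 ^ u * x) := by rw [← mul_assoc, hdu, one_mul]
      _ ≤ _ := this
      _ = _ := by ring
  have hsz : ∀ (j c : ℕ) (x : ℝ), (m : ℝ) ≤ x → u + c + 4 * j ≤ 180 * R →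
      (16 : ℝ) ^ j ≤ δ / 2 ^ c * x := by
    intro j c x hx hj
    have e1 := hδu x (hm0.le.trans hx)
    have e2 : (2 : ℝ) ^ (u + c + 4 * j) ≤ x := (two_le hj).trans (hbig.trans hx)
    have e3 : (2 : ℝ) ^ u * 2 ^ (4 * j) ≤ 2 ^ u * (δ / 2 ^ c * x) := by
      have e4 : (2 : ℝ) ^ (u + c + 4 * j) = 2 ^ c * (2 ^ u * 2 ^ (4 * j)) := by
        rw [pow_add, pow_add]; ring
      have e5 : 2 ^ u * (δ * x) = 2 ^ c * (2 ^ u * (δ / 2 ^ c * x)) := by field_simp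
      rw [e4] at e2
      rw [e5] at e1
      exact le_of_mul_le_mul_left (e2.trans e1) (by positivity)
    rw [h16]
    exact le_of_mul_le_mul_left e3 (by positivity)
  -- The 2R rounds on `A` yield 2^(-R) but shrink `A` by up to 2^(8R+u+2), at most 2^(10R). The 42R
  -- rounds on `B` yield 2^(-21R), of which 2^(20R) pays for replacing |A|² by |A'|². They shrink
  -- `B` by up to 2^(168R+u+1), hence the exponent 170R below.
  obtain ⟨A', hA', B', hB', cA, cB, sA, sB, eE⟩ := exists_subpair_rarely_split hV hτ hA hB E hδ0
    (2 * (21 * R)) (2 * R) (by have := hsz (2 * (21 * R)) 1 _ hmB' (by omega); simpa using this)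
    (by
      have := hsz (2 * R) 2 _ hmA' (by omega)
      have h4 : (2 : ℝ) ^ 2 = 4 := by norm_num
      rwa [h4] at this) hEδ
  have cA' : (A.card : ℝ) ≤ 2 ^ (8 * R + u + 2) * A'.card := by
    calc (A.card : ℝ) ≤ 2 ^ u * (δ * A.card) := hδu _ hA0.le
      _ = 2 ^ u * (4 * (δ / 4 * A.card)) := by ring
      _ ≤ 2 ^ u * (4 * (16 ^ (2 * R) * A'.card)) := by gcongr
      _ = _ := by rw [h16, pow_add, pow_add, show 4 * (2 * R) = 8 * R by ring]; ring
  have cB' : (B.card : ℝ) ≤ 2 ^ (168 * R + u + 1) * B'.card := by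
    calc (B.card : ℝ) ≤ 2 ^ u * (δ * B.card) := hδu _ hB0.le
      _ = 2 ^ u * (2 * (δ / 2 * B.card)) := by ring
      _ ≤ 2 ^ u * (2 * (16 ^ (2 * (21 * R)) * B'.card)) := by gcongr
      _ = _ := by
        rw [h16, pow_add, pow_add, show 4 * (2 * (21 * R)) = 168 * R by ring]; ring
  have sA' : ((splitPairs A' B').card : ℝ) ≤ 1 / 2 ^ R * (A'.card : ℝ) ^ 2 := by
    have e1 : (2 : ℝ) ^ (21 * R) * (splitPairs A' B').card ≤ (A.card : ℝ) ^ 2 := by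
      exact_mod_cast two_pow_mul_le_of_three_pow sA
    have e2 : (A.card : ℝ) ^ 2 ≤ 2 ^ (20 * R) * (A'.card : ℝ) ^ 2 := by
      calc (A.card : ℝ) ^ 2 ≤ (2 ^ (8 * R + u + 2) * A'.card) ^ 2 := by gcongr
        _ = 2 ^ ((8 * R + u + 2) * 2) * (A'.card : ℝ) ^ 2 := by rw [mul_pow, ← pow_mul]
        _ ≤ 2 ^ (20 * R) * (A'.card : ℝ) ^ 2 :=
          mul_le_mul_of_nonneg_right (two_le (by omega)) (by positivity)
    have e3 : (2 : ℝ) ^ (21 * R) = 2 ^ (20 * R) * 2 ^ R := by rw [← pow_add]; congr 1; ring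
    rw [e3, mul_assoc] at e1
    have e4 := le_of_mul_le_mul_left (e1.trans e2) (by positivity)
    rw [one_div, ← div_eq_inv_mul, le_div_iff₀ (by positivity)]
    linarith
  have sB' : ((splitPairs B' A').card : ℝ) ≤ 1 / 2 ^ R * (B'.card : ℝ) ^ 2 := by
    have e1 : (2 : ℝ) ^ R * (splitPairs B' A').card ≤ (B'.card : ℝ) ^ 2 := by
      exact_mod_cast two_pow_mul_le_of_three_pow sB
    rw [one_div, ← div_eq_inv_mul, le_div_iff₀ (by positivity)]
    linarith
  have hlarge : ∀ (a b : ℕ) (X : Finset Plane), (m : ℝ) ≤ 2 ^ a * X.card → a ≤ 170 * R →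
      2 ^ (5 + u + (2 + k) * b + 170 * R) ≤ m → 32 / d * (4 * ((2 ^ k : ℕ) : ℝ)) ^ b ≤ X.card := by
    intro a b X hX ha hb
    have e0 : (2 : ℝ) ^ (5 + u + (2 + k) * b + 170 * R) ≤ m := by exact_mod_cast hb
    have e1 : 32 / d * (4 * ((2 ^ k : ℕ) : ℝ)) ^ b = 2 ^ (5 + u + (2 + k) * b) := by
      rw [hd, pow_add, pow_add, pow_mul, pow_add]
      push_cast
      norm_num
    rw [e1]
    have e2 : (2 : ℝ) ^ (170 * R) * 2 ^ (5 + u + (2 + k) * b) ≤ 2 ^ (170 * R) * X.card := by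
      rw [← pow_add, add_comm (170 * R)]
      refine e0.trans (hX.trans ?_)
      exact mul_le_mul_of_nonneg_right (two_le ha) (by positivity)
    exact le_of_mul_le_mul_left e2 (by positivity)
  obtain ⟨t, htD, htP, hlast⟩ := exists_last_le
    (fun t => 2 ^ (5 + u + (2 + k) * t + 170 * R) ≤ m)
    (le_trans (Nat.pow_le_pow_right (by norm_num) (by omega)) (not_le.1 hsmall).le) D
  have huD : u * t ≤ u * D := Nat.mul_le_mul_left _ htD
  refine (hasCrossingFamily_of_levels hV E (2 ^ k) (by positivity) d hd0 hd1 t A' B' (1 / 2 ^ R)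
    (hA'.trans hA) (hB'.trans hB) (h.mono hA' hB') (by positivity) ?_
    (hlarge _ t A' (hmA'.trans cA') (by omega) htP) (hlarge _ t B' (hmB'.trans cB') (by omega) htP)
    sA' sB' ?_).mono hA' hB' ?_
  · have e1 : (128 / d) ^ t = 2 ^ ((7 + u) * t) := by
      rw [hd, pow_mul, pow_add]; norm_num
    have e2 : d / (128 * ((2 ^ k : ℕ) : ℝ)) = 1 / 2 ^ (u + 7 + k) := by
      rw [hd, pow_add, pow_add]; push_cast; field_simp; norm_num
    rw [e1, e2, div_mul_eq_mul_div, one_mul, div_le_div_iff₀ (by positivity) (by positivity),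
      one_mul, ← pow_add]
    apply two_le
    have : (7 + u) * t = 7 * t + u * t := by ring
    omega
  · rcases hE' with hE' | hE'
    · exact Or.inl fun a ha b hb => hE' a (hA' ha) b (hB' hb)
    · right
      refine le_trans ?_ eE
      rw [hE']
      gcongr
      norm_num
  · have e1 : (d * ((2 ^ k : ℕ) : ℝ) / 16) ^ t = 2 ^ (k * t) / 2 ^ ((u + 4) * t) := by
      rw [hd, pow_mul, pow_mul, ← div_pow, pow_add]; push_cast
      congr 1; field_simp; norm_num
    rw [e1, div_le_div_iff₀ (by positivity) (by positivity), ← pow_add]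
    have hut : (u + 4) * t = u * t + 4 * t := by ring
    -- Either all `D` levels were used and m ≤ 2^(kD), or `m` was too small for one more level,
    -- which bounds it by 2^(kt) up to a factor absorbed in 2^(180R).
    rcases hlast with rfl | hlast
    · have : (m : ℝ) ≤ 2 ^ (k * t) := by exact_mod_cast hmk
      rw [pow_add]
      exact mul_le_mul this (two_le (by omega)) (by positivity) (by positivity)
    · have : (m : ℝ) ≤ 2 ^ (5 + u + (2 + k) * (t + 1) + 170 * R) := by
        exact_mod_cast (not_le.1 hlast).le
      refine (mul_le_mul_of_nonneg_right this (by positivity)).trans ?_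
      rw [← pow_add]
      apply two_le
      have : (2 + k) * (t + 1) = 2 * t + k * t + 2 + k := by ring
      omega

/-! ### From separated sets to the two assertions -/

theorem Cross.symm {e f : Sym2 Plane} (h : Cross e f) : Cross f e := by
  unfold Cross at *
  rwa [Set.inter_comm]

open Classical in
theorem HasCrossingFamily.exists_segments {E : Plane → Plane → Prop} {A B : Finset Plane} {F : ℝ}
    (hAB : LinSep A B) (h : HasCrossingFamily E A B F) :
    ∃ S : Finset (Sym2 Plane), (∀ e ∈ S, ∃ a ∈ A, ∃ b ∈ B, E a b ∧ e = s(a, b)) ∧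
      PairwiseCrossing S ∧ F ≤ (S.card : ℝ) := by
  obtain ⟨S, h1, h2, h3⟩ := h
  refine ⟨S.image fun p => s(p.1, p.2), ?_, ?_, ?_⟩
  · intro e he
    obtain ⟨p, hp, rfl⟩ := Finset.mem_image.1 he
    have := mem_edgesBetween.1 (h1 hp)
    exact ⟨p.1, this.1, p.2, this.2.1, this.2.2, rfl⟩
  · intro e he f hf hne
    obtain ⟨p, hp, rfl⟩ := Finset.mem_image.1 he
    obtain ⟨q, hq, rfl⟩ := Finset.mem_image.1 hf
    rcases h2 p hp q hq (fun h => hne (by rw [h])) with h | h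
    · exact h.cross
    · exact h.cross.symm
  · rw [Finset.card_image_of_injOn]
    · exact h3
    · intro p hp q hq hpq
      have hp' := mem_edgesBetween.1 (h1 hp)
      have hq' := mem_edgesBetween.1 (h1 hq)
      rcases Sym2.eq_iff.1 hpq with h | h
      · exact Prod.ext h.1 h.2
      · exact absurd h.1 (hAB.ne hp'.1 hq'.2.1)

/-- A dense geometric graph contains a dense bipartite subgraph between two separated sets. -/
theorem exists_dense_linSep {V : Finset Plane} {τ : ℝ} (hτ : Set.InjOn (shearCoord τ) V)
    (E : Plane → Plane → Prop) (w : ℕ) (hw : 0 < w) (hwV : w ≤ V.card) (η : ℝ) (hη : 0 ≤ η)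
    (hE : 3 * w * V.card + η * (V.card : ℝ) ^ 2 ≤ (edgesBetween E V V).card) :
    ∃ A ⊆ V, ∃ B ⊆ V, A.card = w ∧ B.card = w ∧ LinSep A B ∧
      η * A.card * B.card ≤ (edgesBetween E A B).card := by
  set n := V.card with hn
  set N := n / w with hN
  have hNw : N * w ≤ n := Nat.div_mul_le_self n w
  have hrest : n - N * w < w := by
    have h1 := Nat.div_add_mod n w
    have h2 := Nat.mod_lt n hw
    rw [mul_comm, ← hN] at h1
    omega
  obtain ⟨T, hT1, hT2, hT3⟩ := shearCoord_slices hτ N w hNw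
  have hsep : ∀ i j, i ≠ j → LinSep (T i) (T j) := by
    intro i j hij
    rcases lt_or_gt_of_ne hij with h | h
    · exact linSep_of_shearCoord (hT3 i j h)
    · exact (linSep_of_shearCoord (hT3 j i h)).symm
  have hdisj : ∀ i j, i ≠ j → Disjoint (T i) (T j) := fun i j hij =>
    Finset.disjoint_left.2 fun _ hx hx' => (hsep i j hij).ne hx hx' rfl
  -- If all pairs of distinct slices are sparse, the other edges number fewer than 3wn: at most wn
  -- inside slices and fewer than 2wn at the leftover points, of which there are fewer than `w`.
  by_contra hcon
  have hlow : ∀ i < N, ∀ j < N, i ≠ j →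
      ((edgesBetween E (T i) (T j)).card : ℝ) ≤ η * (w : ℝ) ^ 2 := by
    intro i hi j hj hij
    by_contra hc
    refine hcon ⟨T i, hT1 i, T j, hT1 j, hT2 i hi, hT2 j hj, hsep i j hij, ?_⟩
    rw [hT2 i hi, hT2 j hj]
    linarith [not_le.1 hc]
  have hsum := card_edgesBetween_le_sum E hT1 hT1 hdisj hdisj hT2 hT2
  rw [← hn] at hsum
  have hsumR : ((edgesBetween E V V).card : ℝ) ≤
      ∑ i ∈ Finset.range N, ∑ j ∈ Finset.range N, ((edgesBetween E (T i) (T j)).card : ℝ)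
        + (n - N * w) * n + n * (n - N * w) := by
    have h' := (Nat.cast_le (α := ℝ)).2 hsum
    push_cast [Nat.cast_sub hNw] at h'
    exact h'
  have hinner : ∀ i ∈ Finset.range N,
      ∑ j ∈ Finset.range N, ((edgesBetween E (T i) (T j)).card : ℝ)
        ≤ N * (η * (w : ℝ) ^ 2) + (w : ℝ) ^ 2 := by
    intro i hi
    have hi' := Finset.mem_range.1 hi
    calc ∑ j ∈ Finset.range N, ((edgesBetween E (T i) (T j)).card : ℝ)
        ≤ ∑ j ∈ Finset.range N, (η * (w : ℝ) ^ 2 + if i = j then (w : ℝ) ^ 2 else 0) := by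
          apply Finset.sum_le_sum
          intro j hj
          split_ifs with hij
          · subst hij
            have := card_edgesBetween_le E (T i) (T i)
            rw [hT2 i hi', ← sq] at this
            have h' : ((edgesBetween E (T i) (T i)).card : ℝ) ≤ (w : ℝ) ^ 2 := by
              exact_mod_cast this
            have : 0 ≤ η * (w : ℝ) ^ 2 := by positivity
            linarith
          · rw [add_zero]
            exact hlow i hi' j (Finset.mem_range.1 hj) hij
      _ = _ := by
          rw [Finset.sum_add_distrib, Finset.sum_ite_eq, if_pos hi]
          simp
  have houter := Finset.sum_le_sum hinner
  rw [Finset.sum_const, Finset.card_range, nsmul_eq_mul] at houter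
  have hNw' : (N * w : ℝ) ≤ n := by exact_mod_cast hNw
  have hrest' : (n : ℝ) - N * w < w := by
    have := (Nat.cast_lt (α := ℝ)).2 hrest
    push_cast [Nat.cast_sub hNw] at this
    exact this
  have hn0 : (0 : ℝ) < n := by exact_mod_cast (hw.trans_le hwV)
  have hw0 : (0 : ℝ) < w := by exact_mod_cast hw
  have f1 : (N : ℝ) * (N * (η * (w : ℝ) ^ 2)) ≤ η * (n : ℝ) ^ 2 := by
    have : (N * w : ℝ) ^ 2 ≤ (n : ℝ) ^ 2 := by gcongr
    have := mul_le_mul_of_nonneg_left this hη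
    linarith
  have f2 : (N : ℝ) * (w : ℝ) ^ 2 ≤ w * n := by
    have := mul_le_mul_of_nonneg_left hNw' hw0.le
    linarith
  have f3 := mul_lt_mul_of_pos_right hrest' hn0
  linarith

theorem exists_many_crossing_segments (n : ℕ) (hn : 2 ≤ n) (V : Finset Plane) (hVn : V.card = n)
    (hV : InGeneralPosition V) :
    ∃ S : Finset (Sym2 Plane), (∀ e ∈ S, DeterminedBy V e) ∧ PairwiseCrossing S ∧
      (n : ℝ) / (2 : ℝ) ^ ((5404 : ℝ) * Real.sqrt (Real.logb 2 (n : ℝ))) ≤ (S.card : ℝ) := by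
  set L := Real.logb 2 (n : ℝ) with hL
  have hn0 : (0 : ℝ) < n := by exact_mod_cast (by omega : 0 < n)
  have hnL : (2 : ℝ) ^ L = n := Real.rpow_logb (by norm_num) (by norm_num) hn0
  have hL1 : 1 ≤ L := by
    rw [hL, Real.le_logb_iff_rpow_le (by norm_num) hn0, Real.rpow_one]
    exact_mod_cast hn
  have hs1 : 1 ≤ Real.sqrt L := by rw [Real.one_le_sqrt]; exact hL1
  set D := ⌈Real.sqrt L⌉₊ with hD
  have hD1 : Real.sqrt L ≤ D := Nat.le_ceil _
  have hD2 : (D : ℝ) < Real.sqrt L + 1 := Nat.ceil_lt_add_one (by positivity)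
  have hDpos : 1 ≤ D := by exact_mod_cast hs1.trans hD1
  obtain ⟨τ, hτ⟩ := exists_injOn_shearCoord V
  obtain ⟨T, hT1, hT2, hT3⟩ := shearCoord_slices hτ 2 (n / 2) (by omega)
  have hsep : LinSep (T 0) (T 1) := linSep_of_shearCoord (hT3 0 1 (by norm_num))
  have hmk : n / 2 ≤ 2 ^ (D * D) := by
    have h1 : (n : ℝ) ≤ 2 ^ (D * D) := by
      rw [← hnL, ← Real.rpow_natCast]
      apply Real.rpow_le_rpow_of_exponent_le (by norm_num)
      push_cast
      calc L = Real.sqrt L * Real.sqrt L := (Real.mul_self_sqrt (by linarith)).symm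
        _ ≤ D * D := mul_le_mul hD1 hD1 (by positivity) (by positivity)
    have h2 : n ≤ 2 ^ (D * D) := by exact_mod_cast h1
    omega
  -- Complete case with u = 0 and k = D, where 7(D+1)+D ≤ 15D because D ≥ 1.
  have hfam := hasCrossingFamily_of_dense hV hτ (hT1 0) (hT1 1) hsep (fun _ _ => True) D D 0
    (n / 2) (15 * D) (by omega) (hT2 0 (by norm_num)).ge (hT2 1 (by norm_num)).ge hmk
    (Or.inl fun _ _ _ _ => trivial)
  obtain ⟨S, hS1, hS2, hS3⟩ := hfam.exists_segments hsep
  refine ⟨S, ?_, hS2, le_trans ?_ hS3⟩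
  · intro e he
    obtain ⟨a, ha, b, hb, -, rfl⟩ := hS1 e he
    refine ⟨by rw [Sym2.mk_isDiag_iff]; exact hsep.ne ha hb, fun p hp => ?_⟩
    rcases Sym2.mem_iff.1 hp with rfl | rfl
    · exact hT1 0 ha
    · exact hT1 1 hb
  · have h4 : (n : ℝ) ≤ 4 * (n / 2 : ℕ) := by exact_mod_cast (by omega : n ≤ 4 * (n / 2))
    rw [div_le_div_iff₀ (by positivity) (by positivity)]
    have h5 : (4 : ℝ) * 2 ^ (180 * (15 * D)) ≤ 2 ^ (5404 * Real.sqrt L) := by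
      have : (4 : ℝ) * 2 ^ (180 * (15 * D)) = (2 : ℝ) ^ ((2 + 180 * (15 * D) : ℕ) : ℝ) := by
        rw [Real.rpow_natCast, pow_add]; norm_num
      rw [this]
      apply Real.rpow_le_rpow_of_exponent_le (by norm_num)
      push_cast
      linarith
    calc (n : ℝ) * 2 ^ (180 * (15 * D)) ≤ 4 * (n / 2 : ℕ) * 2 ^ (180 * (15 * D)) := by gcongr
      _ = (n / 2 : ℕ) * (4 * 2 ^ (180 * (15 * D))) := by ring
      _ ≤ _ := by gcongr

namespace GeometricGraph

open Classical in
theorem ncard_edges_le (G : GeometricGraph) :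
    G.edges.ncard ≤ (edgesBetween G.graph.Adj G.verts G.verts).card := by
  have hsub : G.edges ⊆
      ((edgesBetween G.graph.Adj G.verts G.verts).image fun p => s(p.1, p.2) :
        Finset (Sym2 Plane)) := by
    intro e he
    induction e using Sym2.ind with
    | _ p q =>
      have h := G.support_subset p q he
      rw [Finset.mem_coe, Finset.mem_image]
      exact ⟨(p, q), mem_edgesBetween.2 ⟨h.1, h.2, he⟩, rfl⟩
  have := Set.ncard_le_ncard hsub (Finset.finite_toSet _)
  rw [Set.ncard_coe_finset] at this
  exact this.trans Finset.card_image_le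

theorem exists_many_crossing_edges (n : ℕ) (hn : 2 ≤ n) (ε : ℝ)
    (hε : (Real.logb 2 (n : ℝ)) ^ (-(2 : ℝ) / 3) < ε) (G : GeometricGraph)
    (hGn : G.verts.card = n) (hE : (n : ℝ) ^ (2 - ε) ≤ (G.edges.ncard : ℝ)) :
    ∃ S : Finset (Sym2 Plane), (∀ e ∈ S, e ∈ G.edges) ∧ PairwiseCrossing S ∧
      (n : ℝ) ^ (1 - (20000 : ℝ) * Real.sqrt ε) ≤ (S.card : ℝ) := by
  have hn0 : (0 : ℝ) < n := by exact_mod_cast (by omega : 0 < n)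
  set L := Real.logb 2 (n : ℝ) with hL
  have hnL : (2 : ℝ) ^ L = n := Real.rpow_logb (by norm_num) (by norm_num) hn0
  have hL1 : 1 ≤ L := by
    rw [hL, Real.le_logb_iff_rpow_le (by norm_num) hn0, Real.rpow_one]
    exact_mod_cast hn
  have hL0 : 0 < L := by linarith
  have hε0 : 0 < ε := (Real.rpow_pos_of_pos hL0 _).trans hε
  set x := Real.sqrt ε with hx
  have hx0 : 0 < x := Real.sqrt_pos.2 hε0
  have hxε : x ^ 2 = ε := Real.sq_sqrt hε0.le
  -- Here the claimed bound is at most 1, and a single edge suffices.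
  by_cases hbig : 1 ≤ 20000 * x
  · have hne : G.edges.Nonempty := by
      rw [← Set.ncard_pos G.finite_edges]
      exact_mod_cast (Real.rpow_pos_of_pos hn0 _).trans_le hE
    obtain ⟨e, he⟩ := hne
    refine ⟨{e}, by simpa using he, ?_, ?_⟩
    · intro a ha b hb hab
      rw [Finset.mem_singleton] at ha hb
      exact absurd (ha.trans hb.symm) hab
    · rw [Finset.card_singleton, Nat.cast_one]
      apply Real.rpow_le_one_of_one_le_of_nonpos
      · exact_mod_cast (by omega : 1 ≤ n)
      · linarith
  have hx1 : x < 1 / 2 := by linarith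
  -- The lower bound on `ε` in usable form: 1/x < x²L, so the number of levels is dominated by the
  -- logarithm εL of the inverse density.
  have hx3 : 1 < x ^ 3 * L := by
    have h1 : (L ^ (-(2 : ℝ) / 3)) ^ (3 : ℕ) < ε ^ 3 :=
      pow_lt_pow_left₀ hε (Real.rpow_nonneg hL0.le _) (by norm_num)
    have h2 : (L ^ (-(2 : ℝ) / 3)) ^ (3 : ℕ) = (L ^ 2)⁻¹ := by
      rw [← Real.rpow_natCast, ← Real.rpow_mul hL0.le,
        show (-(2 : ℝ) / 3) * ((3 : ℕ) : ℝ) = -((2 : ℕ) : ℝ) by norm_num,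
        Real.rpow_neg hL0.le, Real.rpow_natCast]
    rw [h2, ← hxε, inv_lt_iff_one_lt_mul₀ (by positivity)] at h1
    have h3 : 1 < (x ^ 3 * L) ^ 2 := by nlinarith
    by_contra hc
    have : (x ^ 3 * L) ^ 2 ≤ 1 := pow_le_one₀ (by positivity) (not_lt.1 hc)
    linarith
  have hinv : 1 / x ≤ x ^ 2 * L := by
    rw [div_le_iff₀ hx0]; nlinarith
  have hinv2 : 2 ≤ 1 / x := by rw [le_div_iff₀ hx0]; linarith
  have hxx : x ^ 2 * L ≤ x * L := by nlinarith [mul_pos hx0 hL0]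
  set D := ⌈1 / x⌉₊ with hD
  set k := ⌈x * L⌉₊ with hk
  -- The three terms absorb the density n^(-ε), the decay 4^D over the levels, and the constant in
  -- 4·2^(-u)·4^D ≤ n^(-ε)/2. Both uD and `k` are O(xL).
  set u := ⌈x ^ 2 * L⌉₊ + 2 * D + 3 with hu
  have hD1 : 1 / x ≤ D := Nat.le_ceil _
  have hD2 : (D : ℝ) < 1 / x + 1 := Nat.ceil_lt_add_one (by positivity)
  have hk1 : x * L ≤ k := Nat.le_ceil _
  have hk2 : (k : ℝ) < x * L + 1 := Nat.ceil_lt_add_one (by positivity)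
  have hc1 : x ^ 2 * L ≤ ⌈x ^ 2 * L⌉₊ := Nat.le_ceil _
  have hc2 : (⌈x ^ 2 * L⌉₊ : ℝ) < x ^ 2 * L + 1 := Nat.ceil_lt_add_one (by positivity)
  set R := (7 + u) * (D + 1) + k with hR
  have hR1 : (R : ℝ) ≤ 56 * (x * L) := by
    have e1 : (7 + u : ℝ) ≤ 15 * (x ^ 2 * L) := by rw [hu]; push_cast; linarith
    have e2 : (D + 1 : ℝ) ≤ 3 * (1 / x) := by linarith
    have e3 : (7 + u : ℝ) * (D + 1) ≤ 15 * (x ^ 2 * L) * (3 * (1 / x)) :=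
      mul_le_mul e1 e2 (by positivity) (by positivity)
    have e4 : 15 * (x ^ 2 * L) * (3 * (1 / x)) = 45 * (x * L) := by field_simp; norm_num
    rw [hR]; push_cast
    linarith
  have hpow : ∀ y : ℝ, (n : ℝ) ^ y = 2 ^ (L * y) := fun y => by
    rw [Real.rpow_mul (by norm_num), hnL]
  obtain ⟨τ, hτ⟩ := exists_injOn_shearCoord G.verts
  -- With w ≤ y the loss 3wn is at most half of n^(2-ε), leaving density n^(-ε)/2.
  set y : ℝ := (n : ℝ) ^ (1 - ε) / 6 with hy
  have hy1 : 1 ≤ y := by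
    rw [hy, le_div_iff₀ (by norm_num), hpow]
    have : (3 : ℝ) ≤ L * (1 - ε) := by
      have h8 : 8 ≤ L := by
        have : x ^ 3 ≤ (1 / 2) ^ 3 := by gcongr
        nlinarith
      have : ε ≤ 1 / 4 := by nlinarith
      nlinarith
    calc 1 * 6 ≤ (2 : ℝ) ^ (3 : ℝ) := by norm_num
      _ ≤ _ := Real.rpow_le_rpow_of_exponent_le (by norm_num) this
  set w := ⌊y⌋₊ with hw
  have hw1 : (w : ℝ) ≤ y := Nat.floor_le (by linarith)
  have hw2 : y < w + 1 := Nat.lt_floor_add_one y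
  have hw3 : 1 ≤ w := Nat.le_floor (by exact_mod_cast hy1)
  have hw4 : y / 2 ≤ w := by
    have : (1 : ℝ) ≤ w := by exact_mod_cast hw3
    linarith
  have hyn : (n : ℝ) ^ (1 - ε) ≤ n := by
    calc (n : ℝ) ^ (1 - ε) ≤ (n : ℝ) ^ (1 : ℝ) :=
        Real.rpow_le_rpow_of_exponent_le (by exact_mod_cast (by omega : 1 ≤ n)) (by linarith)
      _ = n := Real.rpow_one _
  have hwn : w ≤ n := by
    have : (w : ℝ) ≤ n := by linarith
    exact_mod_cast this
  have hsplit : (n : ℝ) ^ (2 - ε) = n ^ (1 - ε) * n := by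
    rw [show (2 : ℝ) - ε = (1 - ε) + 1 by ring, Real.rpow_add hn0, Real.rpow_one]
  have hsplit' : (n : ℝ) ^ (2 - ε) = n ^ (-ε) * (n : ℝ) ^ 2 := by
    rw [show (2 : ℝ) - ε = -ε + (2 : ℕ) by push_cast; ring, Real.rpow_add hn0, Real.rpow_natCast]
  obtain ⟨A, hA, B, hB, hAw, hBw, hsep, hAB⟩ := exists_dense_linSep hτ G.graph.Adj w hw3
    (by rw [hGn]; exact hwn) ((n : ℝ) ^ (-ε) / 2) (by positivity) (by
      rw [hGn]
      have e1 : (G.edges.ncard : ℝ) ≤ (edgesBetween G.graph.Adj G.verts G.verts).card := by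
        exact_mod_cast G.ncard_edges_le
      have e2 : 3 * (w : ℝ) * n ≤ n ^ (1 - ε) * n / 2 := by
        have := mul_le_mul_of_nonneg_right hw1 hn0.le
        rw [hy] at this
        linarith
      rw [← hsplit] at e2
      linarith)
  have hfam := hasCrossingFamily_of_dense G.generalPosition hτ hA hB hsep G.graph.Adj D k u w R
    le_rfl hAw.ge hBw.ge (by
      have h1 : (w : ℝ) ≤ 2 ^ (k * D) := by
        have h2 : (w : ℝ) ≤ n := by exact_mod_cast hwn
        refine h2.trans ?_
        rw [← hnL, ← Real.rpow_natCast]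
        apply Real.rpow_le_rpow_of_exponent_le (by norm_num)
        push_cast
        calc L = x * L * (1 / x) := by field_simp
          _ ≤ k * D := mul_le_mul hk1 hD1 (by positivity) (by positivity)
      exact_mod_cast h1) (Or.inr (by
      refine le_trans ?_ hAB
      have e1 : (4 : ℝ) * (1 / 2 ^ u) * 4 ^ D ≤ (n : ℝ) ^ (-ε) / 2 := by
        have e2 : (4 : ℝ) * (1 / 2 ^ u) * 4 ^ D = (2 : ℝ) ^ (-(⌈x ^ 2 * L⌉₊ : ℝ)) / 2 := by
          rw [Real.rpow_neg (by norm_num), Real.rpow_natCast, hu, pow_add, pow_add, pow_mul]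
          field_simp; norm_num
        rw [e2, hpow]
        apply div_le_div_of_nonneg_right _ (by norm_num)
        apply Real.rpow_le_rpow_of_exponent_le (by norm_num)
        rw [← hxε]
        linarith
      gcongr))
  obtain ⟨S, hS1, hS2, hS3⟩ := hfam.exists_segments hsep
  refine ⟨S, ?_, hS2, le_trans ?_ hS3⟩
  · intro e he
    obtain ⟨a, -, b, -, hab, rfl⟩ := hS1 e he
    exact hab
  · rw [le_div_iff₀ (by positivity)]
    calc (n : ℝ) ^ (1 - 20000 * x) * 2 ^ (180 * R)
        = 2 ^ (L * (1 - 20000 * x) + (180 * R : ℕ)) := by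
          rw [Real.rpow_add (by norm_num), Real.rpow_natCast, hpow]
      -- Since 180·56 = 10080, the constant 20000 leaves room for ε = x² and the additive 4.
      _ ≤ 2 ^ (L * (1 - ε) + -4) := by
          apply Real.rpow_le_rpow_of_exponent_le (by norm_num)
          push_cast
          rw [← hxε]
          linarith
      _ = (n : ℝ) ^ (1 - ε) / 16 := by
          rw [Real.rpow_add (by norm_num), ← hpow, Real.rpow_neg (by norm_num)]
          norm_num
          ring
      _ ≤ w := by
          have : 0 ≤ (n : ℝ) ^ (1 - ε) := by positivity
          rw [hy] at hw4
          linarith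

end GeometricGraph

theorem theorem1 :
    (∃ C : ℝ, 0 < C ∧ ∀ n : ℕ, 2 ≤ n → ∀ V : Finset Plane, V.card = n → InGeneralPosition V →
      ∃ S : Finset (Sym2 Plane), (∀ e ∈ S, DeterminedBy V e) ∧ PairwiseCrossing S ∧
        (n : ℝ) / (2 : ℝ) ^ (C * Real.sqrt (Real.logb 2 (n : ℝ))) ≤ (S.card : ℝ)) ∧
    (∃ c : ℝ, 0 < c ∧ ∀ n : ℕ, 2 ≤ n → ∀ ε : ℝ,
      (Real.logb 2 (n : ℝ)) ^ (-(2 : ℝ) / 3) < ε →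
      ∀ G : GeometricGraph, G.verts.card = n →
        (n : ℝ) ^ (2 - ε) ≤ (G.edges.ncard : ℝ) →
        ∃ S : Finset (Sym2 Plane), (∀ e ∈ S, e ∈ G.edges) ∧ PairwiseCrossing S ∧
          (n : ℝ) ^ (1 - c * Real.sqrt ε) ≤ (S.card : ℝ)) :=
  ⟨⟨5404, by norm_num, exists_many_crossing_segments⟩,
    ⟨20000, by norm_num, GeometricGraph.exists_many_crossing_edges⟩⟩
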